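/- \textbf{Setting.} Fix integers $1\le d<r$ (where $r=d^*_{\mathrm F}$ is the number of factors). For each sample size $n$ let $p=p_n$ and $d_{\max}=d_{\max,n}$ be integers with $r\le d_{\max}\le p$, and assume $p_n\to\infty$ and $(\log p_n)/n\to0$ as $n\to\infty$. Consider the factor model $$X=Bf+u\in\mathbb R^{p},\qquad B=B_n=(\beta_1,\dots,\beta_r)\in\mathbb R^{p\times r},$$ where $(f,u)\in\mathbb R^{r}\times\mathbb R^{p}$ has joint law $\mathbb P=\mathbb P_n$ (the response $Y=m(f)+\varepsilon$ of the factor regression plays no role below). The usual normalization is in force: $\mathbb E(ff^\top)=I_r$, the columns of $B$ are orthogonal, and $\|\beta_1\|_2\ge\dots\ge\|\beta_r\|_2$. \textbf{PCA-based representation.} Let $(f_i,u_i)$, $i\in[n]$, be i.i.d. from $\mathbb P_n$, let $X_i=Bf_i+u_i$, and let $T_n\subseteq[n]$ be a deterministic training set with $|T_n|\ge\kappa n$ for all large $n$, where $\kappa>0$ is fixed (for example, the complement of one of $K\ge2$ folds of equal size). Let $\widehat v_1,\dots,\widehat v_{d_{\max}}\in\mathbb R^p$ be any choice of orthonormal leading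 eigenvectors (eigenvalues in nonincreasing order) of the sample covariance matrix $|T_n|^{-1}\sum_{i\in T_n}(X_i-\bar X)(X_i-\bar X)^\top$, where $\bar X=|T_n|^{-1}\sum_{i\in T_n}X_i$. Put $$W=\sqrt p\,[\widehat v_1,\dots,\widehat v_{d_{\max}}],\qquad \widehat R=\widehat\varphi(X)=p^{-1}W^\top X\in\mathbb R^{d_{\max}},\qquad H_d=p^{-1}W_d^\top B_d\in\mathbb R^{d\times d},$$ where $W_d$ and $B_d$ consist of the first $d$ columns of $W$ and $B$. A subscript $[d]$ denotes the first $d$ coordinates of a vector. \textbf{Assumptions.} There are constants $C_1,C_2,C_3,C,c>0$ that do not depend on $n$ such that: \begin{itemize} \item[(D1)] $|B_{ij}|\le C_1$ for all $i\in[p]$, $j\in[r]$; each $f_i$ and each $u_j$ has mean zero and takes values in $[-C_2,C_2]$ almost surely; \item[(D2)] $\sum_{j\ne j'}|\mathbb E(u_ju_{j'})|=O(p)$; \item[(D3)] $\max_{i\in[p],\,j\in[d_{\max}]}|W_{ij}|\le C_3$ with probability tending to one; \item[(D4$'$)] for all large $n$, the $r$ eigenvalues (with multiplicity) of $p^{-1}B^\top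 B$ lie in $[c,C]$ and any two of them differ by at least $c$. \end{itemize} \textbf{Conclusion.} With probability tending to one $H_d$ is invertible, and with $O=H_d^{-1}$, $$\|O\widehat R_{[d]}-f_{[d]}\|_{L_2(\mathbb P)}=O_{\mathbb P}(\delta_n),\qquad \delta_n=n^{-1/2}+(n/\log p)^{-1/2}+p^{-1/2}.$$ Here $\|O\widehat R_{[d]}-f_{[d]}\|_{L_2(\mathbb P)}=\big(\int\|O\,(\widehat\varphi(Bf+u))_{[d]}-f_{[d]}\|_2^2\,d\mathbb P_n(f,u)\big)^{1/2}$, computed over a fresh draw $(f,u)$ with $\widehat\varphi$ and $O$ held fixed, and $O_{\mathbb P}(\delta_n)$ means: for every $\varepsilon>0$ there is $M$ such that the probability that this norm exceeds $M\delta_n$ is at most $\varepsilon$ for all large $n$. -/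

import Mathlib

open MeasureTheory ProbabilityTheory Filter Topology Matrix Asymptotics
open scoped ENNReal

noncomputable section

/-- One draw `z = (f, u)` of the latent factors `f ∈ ℝ^r` and the idiosyncratic noise `u ∈ ℝ^p`. -/
abbrev FactorDraw (r p : ℕ) : Type := (Fin r → ℝ) × (Fin p → ℝ)

/-- The predictor `X = B f + u` of the factor model with loading matrix `B`. -/
def predictor {r p : ℕ} (B : Matrix (Fin p) (Fin r) ℝ) (z : FactorDraw r p) : Fin p → ℝ :=
  B *ᵥ z.1 + z.2

/-- The average of the vectors `x i`, `i ∈ T`. -/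
def sampleMean {ι : Type*} {p : ℕ} (T : Finset ι) (x : ι → Fin p → ℝ) : Fin p → ℝ :=
  (T.card : ℝ)⁻¹ • ∑ i ∈ T, x i

/-- The sample covariance matrix of the vectors `x i`, `i ∈ T`. -/
def sampleCov {ι : Type*} {p : ℕ} (T : Finset ι) (x : ι → Fin p → ℝ) :
    Matrix (Fin p) (Fin p) ℝ :=
  (T.card : ℝ)⁻¹ •
    ∑ i ∈ T, vecMulVec (x i - sampleMean T x) (x i - sampleMean T x)

/-- The first `d` columns of a matrix with `k ≥ d` columns. -/
def firstCols {p d k : ℕ} (h : d ≤ k) (M : Matrix (Fin p) (Fin k) ℝ) :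
    Matrix (Fin p) (Fin d) ℝ :=
  M.submatrix id (Fin.castLE h)

/-- The first `d` coordinates `v_{[d]}` of a vector with `k ≥ d` coordinates. -/
def firstCoords {d k : ℕ} (h : d ≤ k) (v : Fin k → ℝ) : Fin d → ℝ :=
  fun i => v (Fin.castLE h i)

/-- The columns of `V` are `k` leading orthonormal eigenvectors of the symmetric matrix `A`: they are
the first `k` vectors of an orthonormal eigenbasis listed along nonincreasing eigenvalues. Signs,
and bases of multiple eigenspaces, are arbitrary. -/
def IsLeadingEigenvectors {p k : ℕ} (A : Matrix (Fin p) (Fin p) ℝ)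
    (V : Matrix (Fin p) (Fin k) ℝ) : Prop :=
  ∃ (h : k ≤ p) (Q : Matrix (Fin p) (Fin p) ℝ) (ev : Fin p → ℝ),
    Qᵀ * Q = 1 ∧ Antitone ev ∧ A * Q = Q * diagonal ev ∧ V = firstCols h Q

/-- The matrix `W = √p [v₁, …, v_k]` built from the matrix `V = [v₁, …, v_k]`. -/
def pcaW {p k : ℕ} (V : Matrix (Fin p) (Fin k) ℝ) : Matrix (Fin p) (Fin k) ℝ :=
  Real.sqrt p • V

/-- The representation `R̂ = φ̂(x) = p⁻¹ Wᵀ x`. -/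
def pcaRep {p k : ℕ} (W : Matrix (Fin p) (Fin k) ℝ) (x : Fin p → ℝ) : Fin k → ℝ :=
  (p : ℝ)⁻¹ • (Wᵀ *ᵥ x)

/-- The matrix `H_d = p⁻¹ W_dᵀ B_d`, where `W_d` and `B_d` consist of the first `d` columns of `W`
and of `B`. -/
def pcaH {p d k r : ℕ} (hk : d ≤ k) (hr : d ≤ r) (W : Matrix (Fin p) (Fin k) ℝ)
    (B : Matrix (Fin p) (Fin r) ℝ) : Matrix (Fin d) (Fin d) ℝ :=
  (p : ℝ)⁻¹ • ((firstCols hk W)ᵀ * firstCols hr B)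

/-- The representation error `‖O R̂_{[d]} - f_{[d]}‖` in `L₂(P)`, with the Euclidean norm on `ℝ^d`.
The map `φ̂` (that is, `W`) and the matrix `O` are held fixed and the norm is taken over a
fresh draw `z = (f, u)` from `P`. -/
def reprError {p d k r : ℕ} (hk : d ≤ k) (hr : d ≤ r) (P : Measure (FactorDraw r p))
    (B : Matrix (Fin p) (Fin r) ℝ) (W : Matrix (Fin p) (Fin k) ℝ)
    (O : Matrix (Fin d) (Fin d) ℝ) : ℝ≥0∞ :=
  eLpNorm (fun z : FactorDraw r p =>
    WithLp.toLp 2 (O *ᵥ firstCoords hk (pcaRep W (predictor B z)) - firstCoords hr z.1)) 2 P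

/-- The Gram matrix `p⁻¹ Bᵀ B`. -/
def loadingGram {p r : ℕ} (B : Matrix (Fin p) (Fin r) ℝ) : Matrix (Fin r) (Fin r) ℝ :=
  (p : ℝ)⁻¹ • (Bᵀ * B)

theorem loadingGram_isHermitian {p r : ℕ} (B : Matrix (Fin p) (Fin r) ℝ) :
    (loadingGram B).IsHermitian := by
  ext i j
  simp [loadingGram, Matrix.mul_apply, mul_comm]

/-- `ξ_n = O_P(a_n)`: for every `ε > 0` there is `M` such that `μ_n(ξ_n > M a_n) ≤ ε` for all
large `n`. -/
def IsBigOP {Ω : ℕ → Type*} [∀ n, MeasurableSpace (Ω n)] (μ : ∀ n, Measure (Ω n))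
    (ξ : ∀ n, Ω n → ℝ≥0∞) (a : ℕ → ℝ) : Prop :=
  ∀ ε : ℝ, 0 < ε → ∃ M : ℝ, 0 < M ∧ ∀ᶠ n in atTop,
    μ n {ω | ENNReal.ofReal (M * a n) < ξ n ω} ≤ ENNReal.ofReal ε

/-- The rate `δ = n^{-1/2} + (n / log p)^{-1/2} + p^{-1/2}`. -/
def pcaRate (n p : ℕ) : ℝ :=
  (n : ℝ) ^ (-(1 / 2) : ℝ) + ((n : ℝ) / Real.log p) ^ (-(1 / 2) : ℝ) + (p : ℝ) ^ (-(1 / 2) : ℝ)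

end

/-! Write `S` for the sample covariance, `v_i` for its leading unit eigenvectors with eigenvalues
`λ_i`, and `p μ_j = ‖β_j‖²`. Since `R̂ = p^{-1/2} (⟨v_i, X⟩)_i`, the residual `R̂_{[d]} - H_d
f_{[d]}` has coordinates `p^{-1/2} (∑_{j > d} ⟨β_j, v_i⟩ f_j + ⟨v_i, u⟩)`. So three things are
needed: a lower bound on `H_d`, a small overlap of `v_1, …, v_d` with the trailing loading columns,
and bounded noise in the directions `v_i`.

The overlap comes from the identity `(λ_i - p μ_j) ⟨β_j, v_i⟩ = β_jᵀ (S - B Bᵀ) v_i`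
(`col_dotProduct_eigen`). For `i ≤ d < j` the eigenvalue gap and the lower half of Weyl's inequality
make the first factor at least `p c / 2`.

The error `S - B Bᵀ` is bounded at two levels of precision. Factors and noise may be correlated, so
Cauchy–Schwarz bounds the population part by `‖Bᵀ x‖` and by `noiseSize`, the `L₂` size of `x ⬝ᵥ u`.
In an arbitrary direction this gives an operator bound `p η` with `η` of order `n^{-1/2} + p^{-1/4}`
(`abs_bilin_error_le_opNorm`): too slow for the rate, but enough for the eigenvalue gap and for
invertibility of `H_d`. The columns `β_j` and `√p v_i` have bounded entries, and in such flat
directions weak dependence is fully effective (`noiseSize_le_of_bounded`), which yields the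
`p^{-1/2}` term.

The sampling part is measured in Frobenius norm: averaging the `p²` entrywise mean square errors
gives `p n^{-1/2}` with no maximum over entries. The bound obtained is thus `n^{-1/2} + p^{-1/2}`,
which is at most `δ_n`. -/

/-! ### Euclidean and Frobenius norms. -/

/-- The Euclidean norm of a coordinate vector. -/
noncomputable def euclNorm {ι : Type*} [Fintype ι] (x : ι → ℝ) : ℝ := √(x ⬝ᵥ x)

theorem dotProduct_self_nonneg_real {ι : Type*} [Fintype ι] (x : ι → ℝ) : 0 ≤ x ⬝ᵥ x :=
  Finset.sum_nonneg fun i _ => mul_self_nonneg (x i)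

theorem euclNorm_nonneg {ι : Type*} [Fintype ι] (x : ι → ℝ) : 0 ≤ euclNorm x := Real.sqrt_nonneg _

theorem euclNorm_sq {ι : Type*} [Fintype ι] (x : ι → ℝ) : euclNorm x ^ 2 = x ⬝ᵥ x :=
  Real.sq_sqrt (dotProduct_self_nonneg_real x)

theorem abs_dotProduct_le {ι : Type*} [Fintype ι] (x y : ι → ℝ) :
    |x ⬝ᵥ y| ≤ euclNorm x * euclNorm y := by
  refine abs_le_of_sq_le_sq ?_ (mul_nonneg (euclNorm_nonneg x) (euclNorm_nonneg y))
  rw [mul_pow, euclNorm_sq, euclNorm_sq]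
  simpa [dotProduct, sq] using Finset.sum_mul_sq_le_sq_mul_sq Finset.univ x y

/-- The Frobenius norm of a real matrix. -/
noncomputable def frobNorm {ι κ : Type*} [Fintype ι] [Fintype κ] (D : Matrix ι κ ℝ) : ℝ :=
  √(∑ a, ∑ b, D a b ^ 2)

theorem frobNorm_nonneg {ι κ : Type*} [Fintype ι] [Fintype κ] (D : Matrix ι κ ℝ) :
    0 ≤ frobNorm D :=
  Real.sqrt_nonneg _

theorem frobNorm_sq {ι κ : Type*} [Fintype ι] [Fintype κ] (D : Matrix ι κ ℝ) :
    frobNorm D ^ 2 = ∑ a, ∑ b, D a b ^ 2 :=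
  Real.sq_sqrt (Finset.sum_nonneg fun _ _ => Finset.sum_nonneg fun _ _ => sq_nonneg _)

theorem abs_bilin_le_frobNorm {ι κ : Type*} [Fintype ι] [Fintype κ] (D : Matrix ι κ ℝ)
    (x : ι → ℝ) (y : κ → ℝ) :
    |x ⬝ᵥ D *ᵥ y| ≤ frobNorm D * (euclNorm x * euclNorm y) := by
  have h1 := abs_dotProduct_le x (D *ᵥ y)
  have h2 : euclNorm (D *ᵥ y) ≤ frobNorm D * euclNorm y := by
    refine abs_le_of_sq_le_sq' ?_ (mul_nonneg (frobNorm_nonneg D) (euclNorm_nonneg y)) |>.2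
    rw [mul_pow, euclNorm_sq (D *ᵥ y), euclNorm_sq y, frobNorm_sq, Finset.sum_mul]
    refine Finset.sum_le_sum fun a _ => ?_
    have := Finset.sum_mul_sq_le_sq_mul_sq Finset.univ (D a) y
    simpa [dotProduct, mulVec, sq] using this
  nlinarith [mul_le_mul_of_nonneg_left h2 (euclNorm_nonneg x)]

/-! ### Eigenvalues and eigenvectors of a perturbation of `B Bᵀ`. -/

section Eigen

variable {p r : ℕ} {A Q : Matrix (Fin p) (Fin p) ℝ} {ev : Fin p → ℝ}

theorem dotProduct_orthogonal (hQ : Qᵀ * Q = 1) (w : Fin p → ℝ) :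
    (Qᵀ *ᵥ w) ⬝ᵥ (Qᵀ *ᵥ w) = w ⬝ᵥ w := by
  have hQ' : Q * Qᵀ = 1 := mul_eq_one_comm.mp hQ
  rw [dotProduct_mulVec, vecMul_transpose, mulVec_mulVec, hQ', one_mulVec]

theorem eigen_decomp (hQ : Qᵀ * Q = 1) (hA : A * Q = Q * diagonal ev) (w : Fin p → ℝ) :
    w ⬝ᵥ A *ᵥ w = ∑ i, ev i * (Qᵀ *ᵥ w) i ^ 2 := by
  have hQ' : Q * Qᵀ = 1 := mul_eq_one_comm.mp hQ
  have h1 : A = Q * diagonal ev * Qᵀ := by rw [← hA, mul_assoc, hQ', mul_one]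
  rw [h1, ← mulVec_mulVec, ← mulVec_mulVec, dotProduct_mulVec, ← mulVec_transpose]
  simp only [dotProduct, mulVec_diagonal]
  exact Finset.sum_congr rfl fun i _ => by ring

theorem eigen_col (hA : A * Q = Q * diagonal ev) (k : Fin p) : A *ᵥ Q.col k = ev k • Q.col k := by
  ext i
  have := congrFun (congrFun hA i) k
  rw [mul_diagonal] at this
  simpa [mulVec, dotProduct, mul_apply, col, mul_comm] using this

/-- A nonzero coefficient vector supported on the first `k + 1` coordinates whose image under `B` is
orthogonal to the first `k` columns of `Q`. -/
theorem exists_coeff_orthogonal (B : Matrix (Fin p) (Fin r) ℝ) (Q : Matrix (Fin p) (Fin p) ℝ)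
    (hr : r ≤ p) (k : Fin r) :
    ∃ y : Fin r → ℝ, y ≠ 0 ∧ (∀ i, k < i → y i = 0) ∧
      ∀ i : Fin r, i < k → (Qᵀ *ᵥ (B *ᵥ y)) (Fin.castLE hr i) = 0 := by
  -- Dimension count as a singular square system: rows `i < k` carry the orthogonality conditions,
  -- rows `i > k` force `y i = 0`, and row `k` is free, hence zero.
  let N : Matrix (Fin r) (Fin r) ℝ := fun i =>
    if i < k then (Qᵀ * B) (Fin.castLE hr i) else if k < i then Pi.single i 1 else 0
  have hdet : N.det = 0 := det_eq_zero_of_row_eq_zero k fun j => by simp [N]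
  obtain ⟨y, hy, hNy⟩ := exists_mulVec_eq_zero_iff.mpr hdet
  refine ⟨y, hy, fun i hi => ?_, fun i hi => ?_⟩
  · have := congrFun hNy i
    simpa [N, mulVec, hi, hi.not_gt] using this
  · have := congrFun hNy i
    rw [mulVec_mulVec]
    simpa [N, mulVec, hi] using this

variable {B : Matrix (Fin p) (Fin r) ℝ} {ν : Fin r → ℝ}

theorem transpose_mulVec_mulVec (hB : Bᵀ * B = diagonal ν) (y : Fin r → ℝ) :
    Bᵀ *ᵥ (B *ᵥ y) = fun i => ν i * y i := by
  rw [mulVec_mulVec, hB]; ext i; rw [mulVec_diagonal]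

theorem bilin_loading (x y : Fin p → ℝ) :
    x ⬝ᵥ (B * Bᵀ) *ᵥ y = (Bᵀ *ᵥ x) ⬝ᵥ (Bᵀ *ᵥ y) := by
  rw [← mulVec_mulVec, dotProduct_mulVec, ← mulVec_transpose]

/-- Lower half of Weyl's inequality for the leading eigenvalues of a perturbation of `B Bᵀ`. -/
theorem eigenvalue_lower (hQ : Qᵀ * Q = 1) (hev : Antitone ev) (hA : A * Q = Q * diagonal ev)
    (hB : Bᵀ * B = diagonal ν) (hν : ∀ i, 0 < ν i) (hνa : Antitone ν) {η : ℝ}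
    (hE : ∀ x, |x ⬝ᵥ (A - B * Bᵀ) *ᵥ x| ≤ η * (x ⬝ᵥ x)) (hr : r ≤ p) (k : Fin r) :
    ν k - η ≤ ev (Fin.castLE hr k) := by
  -- Courant–Fischer test vector: `w` lies in the span of the first `k + 1` loading columns and is
  -- orthogonal to the first `k` eigenvectors, so its quadratic form is at most `ev k` times `w ⬝ᵥ
  -- w` for `A` and at least `ν k` times it for `B Bᵀ`.
  obtain ⟨y, hy, hy0, hyQ⟩ := exists_coeff_orthogonal B Q hr k
  set w := B *ᵥ y with hw
  have hww : w ⬝ᵥ w = ∑ i, ν i * y i ^ 2 := by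
    rw [hw, dotProduct_mulVec, ← mulVec_transpose, transpose_mulVec_mulVec hB]
    exact Finset.sum_congr rfl fun i _ => by ring
  have hpos : 0 < w ⬝ᵥ w := by
    rw [hww]
    obtain ⟨i, hi⟩ := Function.ne_iff.mp hy
    exact Finset.sum_pos' (fun i _ => mul_nonneg (hν i).le (sq_nonneg _))
      ⟨i, Finset.mem_univ _, mul_pos (hν i) (sq_pos_of_ne_zero hi)⟩
  have hup : w ⬝ᵥ A *ᵥ w ≤ ev (Fin.castLE hr k) * (w ⬝ᵥ w) := by
    rw [eigen_decomp hQ hA, ← dotProduct_orthogonal hQ w, dotProduct, Finset.mul_sum]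
    refine Finset.sum_le_sum fun i _ => ?_
    by_cases hik : i < Fin.castLE hr k
    · have := hyQ ⟨i, lt_trans hik k.2⟩ hik
      have h0 : (Qᵀ *ᵥ w) i = 0 := this
      simp [h0]
    · rw [← sq]
      exact mul_le_mul_of_nonneg_right (hev (not_lt.mp hik)) (sq_nonneg _)
  have hlow : ν k * (w ⬝ᵥ w) ≤ w ⬝ᵥ (B * Bᵀ) *ᵥ w := by
    rw [bilin_loading, hww, hw, transpose_mulVec_mulVec hB, dotProduct, Finset.mul_sum]
    refine Finset.sum_le_sum fun i _ => ?_
    by_cases hik : k < i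
    · simp [hy0 i hik]
    · nlinarith [mul_le_mul_of_nonneg_right (hνa (not_lt.mp hik))
        (mul_nonneg (hν i).le (sq_nonneg (y i)))]
  have hEw := (abs_le.mp (hE w)).1
  rw [sub_mulVec, dotProduct_sub] at hEw
  have : (ν k - η) * (w ⬝ᵥ w) ≤ ev (Fin.castLE hr k) * (w ⬝ᵥ w) := by linarith
  exact le_of_mul_le_mul_right this hpos

/-- `Q.col k` is an eigenvector of `A` and `B.col j` is one of the symmetric `B * Bᵀ`, so each
matrix can act on the side where it is a scalar. Dividing by the gap bounds an overlap by one entry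
of the perturbation, which is finer than its operator norm. -/
theorem col_dotProduct_eigen (hA : A * Q = Q * diagonal ev) (hB : Bᵀ * B = diagonal ν)
    (j : Fin r) (k : Fin p) :
    (ev k - ν j) * (B.col j ⬝ᵥ Q.col k) = B.col j ⬝ᵥ (A - B * Bᵀ) *ᵥ Q.col k := by
  have h1 : Bᵀ *ᵥ B.col j = fun i => ν i * (Pi.single j 1 : Fin r → ℝ) i := by
    rw [← transpose_mulVec_mulVec hB, mulVec_single_one]
  have h2 : (Bᵀ *ᵥ B.col j) ⬝ᵥ (Bᵀ *ᵥ Q.col k) = ν j * (B.col j ⬝ᵥ Q.col k) := by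
    rw [h1, dotProduct, Finset.sum_eq_single j]
    · simp [mulVec, dotProduct]
    · intro i _ hi; simp [hi]
    · simp
  rw [sub_mulVec, dotProduct_sub, bilin_loading, eigen_col hA, h2, dotProduct_smul, smul_eq_mul]
  ring

end Eigen

/-! ### Square matrices bounded below, and splitting a sum after `d` terms. -/

/-- A lower bound for `Nᵀ` makes a square matrix invertible with the same lower bound. -/
theorem isUnit_of_transpose_lower {d : ℕ} (N : Matrix (Fin d) (Fin d) ℝ) {a : ℝ} (ha : 0 < a)
    (h : ∀ x, a * (x ⬝ᵥ x) ≤ (Nᵀ *ᵥ x) ⬝ᵥ (Nᵀ *ᵥ x)) :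
    IsUnit N ∧ ∀ y, a * (y ⬝ᵥ y) ≤ (N *ᵥ y) ⬝ᵥ (N *ᵥ y) := by
  have hdet : Nᵀ.det ≠ 0 := fun h0 => by
    obtain ⟨x, hx, hx0⟩ := exists_mulVec_eq_zero_iff.mpr h0
    have := h x
    rw [hx0, dotProduct_zero] at this
    have h1 : x ⬝ᵥ x = 0 := le_antisymm (by nlinarith) (dotProduct_self_nonneg_real x)
    exact hx (dotProduct_self_eq_zero.mp h1)
  have hu : IsUnit Nᵀ.det := hdet.isUnit
  refine ⟨(isUnit_iff_isUnit_det N).mpr (by rwa [det_transpose] at hu), fun y => ?_⟩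
  set x := Nᵀ⁻¹ *ᵥ y with hx
  have hxy : Nᵀ *ᵥ x = y := by rw [hx, mulVec_mulVec, mul_nonsing_inv _ hu, one_mulVec]
  -- Duality: Cauchy–Schwarz here, combined with `a * (x ⬝ᵥ x) ≤ y ⬝ᵥ y`, leaves the bound for `N`
  -- after cancelling one factor `y ⬝ᵥ y`.
  have h1 : y ⬝ᵥ y = x ⬝ᵥ (N *ᵥ y) := by
    rw [dotProduct_mulVec, ← mulVec_transpose, hxy]
  have h2 := h x
  rw [hxy] at h2
  have h3 := abs_dotProduct_le x (N *ᵥ y)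
  rw [← h1, abs_of_nonneg (dotProduct_self_nonneg_real y)] at h3
  have h4 : (y ⬝ᵥ y) ^ 2 ≤ (x ⬝ᵥ x) * ((N *ᵥ y) ⬝ᵥ (N *ᵥ y)) := by
    rw [← euclNorm_sq x, ← euclNorm_sq (N *ᵥ y), ← mul_pow]
    exact pow_le_pow_left₀ (dotProduct_self_nonneg_real y) h3 2
  rcases (dotProduct_self_nonneg_real y).eq_or_lt with h0 | hpos
  · rw [← h0, mul_zero]; exact dotProduct_self_nonneg_real _
  · refine le_of_mul_le_mul_left ?_ hpos
    have := mul_le_mul_of_nonneg_right h2 (dotProduct_self_nonneg_real (N *ᵥ y))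
    nlinarith

theorem sum_eq_sum_castLE_add {d r : ℕ} (h : d ≤ r) (g : Fin r → ℝ) :
    ∑ j, g j = ∑ i : Fin d, g (Fin.castLE h i) +
      ∑ j ∈ Finset.univ.filter (fun j : Fin r => d ≤ j.1), g j := by
  rw [← Finset.sum_filter_add_sum_filter_not Finset.univ (fun j : Fin r => j.1 < d) g]
  congr 1
  · symm
    refine Finset.sum_bij (fun i _ => Fin.castLE h i) (fun i _ => by simp)
      (fun i _ j _ hij => Fin.castLE_injective h hij) (fun j hj => ?_) (fun _ _ => rfl)
    exact ⟨⟨j.1, (Finset.mem_filter.mp hj).2⟩, Finset.mem_univ _, rfl⟩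
  · simp only [not_lt]

/-! ### Leading eigenvectors against the loading columns, and the lower bound for `H_d`. -/

section Leading

variable {p k r d : ℕ} {S : Matrix (Fin p) (Fin p) ℝ} {V : Matrix (Fin p) (Fin k) ℝ}
  {B : Matrix (Fin p) (Fin r) ℝ} {μ : Fin r → ℝ} {c C η : ℝ}

theorem euclNorm_col_sq (hB : Bᵀ * B = diagonal fun j => (p : ℝ) * μ j) (j : Fin r) :
    euclNorm (B.col j) ^ 2 = p * μ j := by
  rw [euclNorm_sq]
  have := congrFun (congrFun hB j) j
  simpa [mul_apply, dotProduct, col] using this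

theorem col_dotProduct_self_of_orthonormal {q : ℕ} {Q : Matrix (Fin p) (Fin q) ℝ} (hQ : Qᵀ * Q = 1)
    (i : Fin q) : Q.col i ⬝ᵥ Q.col i = 1 := by
  have := congrFun (congrFun hQ i) i
  simpa [mul_apply, dotProduct, col] using this

theorem IsLeadingEigenvectors.col_dotProduct_self (hV : IsLeadingEigenvectors S V) (i : Fin k) :
    V.col i ⬝ᵥ V.col i = 1 := by
  obtain ⟨hkp, Q, ev, hQ, -, -, rfl⟩ := hV
  exact col_dotProduct_self_of_orthonormal hQ (Fin.castLE hkp i)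

/-- The leading sample eigenvectors are nearly orthogonal to the trailing loading columns. -/
theorem IsLeadingEigenvectors.abs_col_dotProduct_le (hV : IsLeadingEigenvectors S V) (hp : 0 < p)
    (hrk : r ≤ k) (hdr : d ≤ r) (hB : Bᵀ * B = diagonal fun j => (p : ℝ) * μ j) (hc : 0 < c)
    (hμ : ∀ j, c ≤ μ j) (hgap : ∀ i j, i < j → c ≤ μ i - μ j)
    (hE : ∀ x, |x ⬝ᵥ (S - B * Bᵀ) *ᵥ x| ≤ p * η * (x ⬝ᵥ x)) (hη : η ≤ c / 2)
    (i : Fin d) (j : Fin r) (hj : d ≤ j.1) :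
    |B.col j ⬝ᵥ V.col (Fin.castLE (hdr.trans hrk) i)| ≤
      2 / (p * c) * |B.col j ⬝ᵥ (S - B * Bᵀ) *ᵥ V.col (Fin.castLE (hdr.trans hrk) i)| := by
  obtain ⟨hkp, Q, ev, hQ, hev, hA, rfl⟩ := hV
  have hp' : (0 : ℝ) < p := by exact_mod_cast hp
  have hμa : Antitone μ := by
    intro a b hab
    rcases hab.eq_or_lt with rfl | hlt
    · exact le_rfl
    · linarith [hgap a b hlt]
  have hlow := eigenvalue_lower hQ hev hA hB (fun j => mul_pos hp' (hc.trans_le (hμ j)))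
    (fun a b hab => mul_le_mul_of_nonneg_left (hμa hab) hp'.le) hE (hrk.trans hkp)
    (Fin.castLE hdr i)
  have hid := col_dotProduct_eigen hA hB j (Fin.castLE (hrk.trans hkp) (Fin.castLE hdr i))
  have hij : Fin.castLE hdr i < j := Fin.lt_def.mpr (lt_of_lt_of_le i.2 hj)
  have hg := hgap _ _ hij
  -- The population gap is at least `p c`, and Weyl's inequality costs at most `p η ≤ p c / 2`.
  have hgap' : p * c / 2 ≤ ev (Fin.castLE (hrk.trans hkp) (Fin.castLE hdr i)) - p * μ j := by
    nlinarith
  have hcol : (firstCols hkp Q).col (Fin.castLE (hdr.trans hrk) i) =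
      Q.col (Fin.castLE (hrk.trans hkp) (Fin.castLE hdr i)) := rfl
  rw [hcol, ← hid, abs_mul]
  have h0 : 0 < p * c / 2 := by positivity
  rw [abs_of_pos (h0.trans_le hgap'), ← mul_assoc]
  refine le_mul_of_one_le_left (abs_nonneg _) ?_
  calc (1 : ℝ) = 2 / (p * c) * (p * c / 2) := by field_simp
    _ ≤ _ := mul_le_mul_of_nonneg_left hgap' (by positivity)

theorem pcaH_transpose_mulVec (hk : d ≤ k) (hr : d ≤ r) (V : Matrix (Fin p) (Fin k) ℝ)
    (B : Matrix (Fin p) (Fin r) ℝ) (x : Fin d → ℝ) (i : Fin d) :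
    ((pcaH hk hr (pcaW V) B)ᵀ *ᵥ x) i =
      (p : ℝ)⁻¹ * √p * (Bᵀ *ᵥ (firstCols hk V *ᵥ x)) (Fin.castLE hr i) := by
  have h : (pcaH hk hr (pcaW V) B)ᵀ = ((p : ℝ)⁻¹ * √p) • ((firstCols hr B)ᵀ * firstCols hk V) := by
    have : firstCols hk (pcaW V) = √p • firstCols hk V := rfl
    rw [pcaH, this, transpose_smul, transpose_mul, transpose_transpose, Matrix.mul_smul, smul_smul]
  rw [h, smul_mulVec, ← mulVec_mulVec]
  rfl

/-- For `v = ∑ x_i v_i`, the form `vᵀ S v` is at least `p (c - η) ‖x‖²`, hence `‖Bᵀ v‖² ≥ p (c - 2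
η) ‖x‖²`. The trailing coordinates of `Bᵀ v` contribute at most `p (c / 4) ‖x‖²`, and the leading
ones are `√p H_dᵀ x`. With `η ≤ c / 8` what remains is `c - c / 4 - c / 4 = c / 2`. -/
theorem IsLeadingEigenvectors.pcaH_lower (hV : IsLeadingEigenvectors S V) (hp : 0 < p)
    (hrk : r ≤ k) (hdr : d ≤ r) (hB : Bᵀ * B = diagonal fun j => (p : ℝ) * μ j) (hc : 0 < c)
    (hμ : ∀ j, c ≤ μ j) (hμC : ∀ j, μ j ≤ C) (hgap : ∀ i j, i < j → c ≤ μ i - μ j)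
    (hE : ∀ x y, |x ⬝ᵥ (S - B * Bᵀ) *ᵥ y| ≤ p * η * (euclNorm x * euclNorm y))
    (hη : η ≤ c / 8) (hη2 : r ^ 2 * C * η ^ 2 ≤ c ^ 3 / 16) (x : Fin d → ℝ) :
    c / 2 * (x ⬝ᵥ x) ≤ ((pcaH (hdr.trans hrk) hdr (pcaW V) B)ᵀ *ᵥ x) ⬝ᵥ
      ((pcaH (hdr.trans hrk) hdr (pcaW V) B)ᵀ *ᵥ x) := by
  have hp' : (0 : ℝ) < p := by exact_mod_cast hp
  have hEd : ∀ x, |x ⬝ᵥ (S - B * Bᵀ) *ᵥ x| ≤ p * η * (x ⬝ᵥ x) := fun x => by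
    simpa [← sq, euclNorm_sq] using hE x x
  have htrail := fun i j hj => hV.abs_col_dotProduct_le (d := d) hp hrk hdr hB hc hμ hgap hEd
    (by linarith) i j hj
  have hV' := hV
  obtain ⟨hkp, Q, ev, hQ, hev, hA, hVQ⟩ := hV
  have hxx := dotProduct_self_nonneg_real x
  set v := firstCols (hdr.trans hrk) V *ᵥ x with hv
  have hμa : Antitone μ := by
    intro a b hab
    rcases hab.eq_or_lt with rfl | hlt
    · exact le_rfl
    · linarith [hgap a b hlt]
  have hlow := eigenvalue_lower hQ hev hA hB (fun j => mul_pos hp' (hc.trans_le (hμ j)))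
    (fun a b hab => mul_le_mul_of_nonneg_left (hμa hab) hp'.le) hEd (hrk.trans hkp)
  let e : Fin d → Fin p := fun i => Fin.castLE (hrk.trans hkp) (Fin.castLE hdr i)
  have he : Function.Injective e :=
    (Fin.castLE_injective (hrk.trans hkp)).comp (Fin.castLE_injective hdr)
  have hVe : firstCols (hdr.trans hrk) V = Q.submatrix id e := by rw [hVQ]; rfl
  have hcoef : (Q.submatrix id e)ᵀ * Q.submatrix id e = 1 := by
    have : (Q.submatrix id e)ᵀ * Q.submatrix id e = (Qᵀ * Q).submatrix e e := rfl
    rw [this, hQ, submatrix_one _ he]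
  have hvv : v ⬝ᵥ v = x ⬝ᵥ x := by
    rw [hv, hVe, dotProduct_mulVec, ← mulVec_transpose, mulVec_mulVec, hcoef, one_mulVec]
  have hAv : v ⬝ᵥ S *ᵥ v = ∑ i, ev (e i) * x i ^ 2 := by
    have h1 : S * Q.submatrix id e = Q.submatrix id e * diagonal (ev ∘ e) := by
      have : S * Q.submatrix id e = (S * Q).submatrix id e := rfl
      rw [this, hA]
      ext a b
      simp [mul_diagonal]
    rw [hv, hVe, mulVec_mulVec, h1, ← mulVec_mulVec, dotProduct_mulVec, ← mulVec_transpose,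
      mulVec_mulVec, hcoef, one_mulVec]
    simp only [dotProduct, mulVec_diagonal, Function.comp]
    exact Finset.sum_congr rfl fun i _ => by ring
  have hAv' : p * (c - η) * (x ⬝ᵥ x) ≤ v ⬝ᵥ S *ᵥ v := by
    rw [hAv, dotProduct, Finset.mul_sum]
    refine Finset.sum_le_sum fun i _ => ?_
    rw [← sq]
    refine mul_le_mul_of_nonneg_right ?_ (sq_nonneg _)
    have := hlow (Fin.castLE hdr i)
    nlinarith [hμ (Fin.castLE hdr i)]
  have hEv := (abs_le.mp (hEd v)).2
  rw [sub_mulVec, dotProduct_sub, bilin_loading, hvv] at hEv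
  have hsplit : (Bᵀ *ᵥ v) ⬝ᵥ (Bᵀ *ᵥ v) =
      ∑ i : Fin d, (Bᵀ *ᵥ v) (Fin.castLE hdr i) ^ 2 +
      ∑ j ∈ Finset.univ.filter (fun j : Fin r => d ≤ j.1), (Bᵀ *ᵥ v) j ^ 2 := by
    rw [← sum_eq_sum_castLE_add hdr (fun j => (Bᵀ *ᵥ v) j ^ 2)]
    exact Finset.sum_congr rfl fun i _ => by ring
  -- The sign of `C` is read off an index of `μ`; without any index the trailing sum is empty.
  have hC : 0 ≤ C ∨ r = 0 := by
    rcases Nat.eq_zero_or_pos r with h | h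
    · exact Or.inr h
    · exact Or.inl (hc.le.trans ((hμ ⟨0, h⟩).trans (hμC _)))
  -- Each squared overlap is at most `4 η² p C / c²`. Cauchy–Schwarz over the `d ≤ r` coordinates
  -- and the sum over at most `r` columns give the factor `r²` of `hη2`.
  have htail : ∑ j ∈ Finset.univ.filter (fun j : Fin r => d ≤ j.1), (Bᵀ *ᵥ v) j ^ 2 ≤
      p * (c / 4) * (x ⬝ᵥ x) := by
    have hterm : ∀ j ∈ Finset.univ.filter (fun j : Fin r => d ≤ j.1), (Bᵀ *ᵥ v) j ^ 2 ≤
        r * (4 * η ^ 2 * p * C / c ^ 2) * (x ⬝ᵥ x) := by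
      intro j hj
      have hj' : d ≤ j.1 := (Finset.mem_filter.mp hj).2
      have hC0 : 0 ≤ C := hc.le.trans ((hμ j).trans (hμC j))
      have h1 : (Bᵀ *ᵥ v) j =
          ∑ i, (B.col j ⬝ᵥ V.col (Fin.castLE (hdr.trans hrk) i)) * x i := by
        rw [hv, mulVec_mulVec]; rfl
      have h2 : ∀ i : Fin d, (B.col j ⬝ᵥ V.col (Fin.castLE (hdr.trans hrk) i)) ^ 2 ≤
          4 * η ^ 2 * p * C / c ^ 2 := by
        intro i
        have hV1 : euclNorm (V.col (Fin.castLE (hdr.trans hrk) i)) = 1 := by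
          rw [euclNorm, hV'.col_dotProduct_self, Real.sqrt_one]
        have h3 := (htrail i j hj').trans (mul_le_mul_of_nonneg_left (hE _ _) (by positivity))
        rw [hV1, mul_one] at h3
        have h4 : 2 / (p * c) * (p * η * euclNorm (B.col j)) = 2 * η / c * euclNorm (B.col j) := by
          field_simp
        rw [h4] at h3
        have h5 := pow_le_pow_left₀ (abs_nonneg _) h3 2
        rw [sq_abs, mul_pow, euclNorm_col_sq hB] at h5
        refine h5.trans ?_
        calc (2 * η / c) ^ 2 * (p * μ j) ≤ (2 * η / c) ^ 2 * (p * C) := by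
              gcongr; exact hμC j
          _ = _ := by ring
      rw [h1]
      refine (Finset.sum_mul_sq_le_sq_mul_sq _ _ _).trans ?_
      have h6 : ∑ i, x i ^ 2 = x ⬝ᵥ x := Finset.sum_congr rfl fun i _ => by ring
      rw [h6]
      refine mul_le_mul_of_nonneg_right ?_ hxx
      refine (Finset.sum_le_sum fun i _ => h2 i).trans ?_
      rw [Finset.sum_const, Finset.card_univ, Fintype.card_fin, nsmul_eq_mul]
      refine mul_le_mul_of_nonneg_right (by exact_mod_cast hdr) (by positivity)
    refine (Finset.sum_le_sum hterm).trans ?_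
    rw [Finset.sum_const, nsmul_eq_mul]
    rcases hC with hC | hr
    · have hcard : ((Finset.univ.filter (fun j : Fin r => d ≤ j.1)).card : ℝ) ≤ r := by
        exact_mod_cast (Finset.card_filter_le _ _).trans (by simp)
      calc _ ≤ (r : ℝ) * (r * (4 * η ^ 2 * p * C / c ^ 2) * (x ⬝ᵥ x)) := by gcongr
        _ = 4 * p / c ^ 2 * (r ^ 2 * C * η ^ 2) * (x ⬝ᵥ x) := by ring
        _ ≤ 4 * p / c ^ 2 * (c ^ 3 / 16) * (x ⬝ᵥ x) := by gcongr
        _ = _ := by field_simp; ring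
    · subst hr
      simp only [Finset.univ_eq_empty, Finset.filter_empty, Finset.card_empty, Nat.cast_zero,
        zero_mul]
      positivity
  have hH : ((pcaH (hdr.trans hrk) hdr (pcaW V) B)ᵀ *ᵥ x) ⬝ᵥ
      ((pcaH (hdr.trans hrk) hdr (pcaW V) B)ᵀ *ᵥ x) =
      (p : ℝ)⁻¹ * ∑ i : Fin d, (Bᵀ *ᵥ v) (Fin.castLE hdr i) ^ 2 := by
    rw [dotProduct, Finset.mul_sum]
    refine Finset.sum_congr rfl fun i _ => ?_
    rw [pcaH_transpose_mulVec, ← hv]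
    have hs : √(p : ℝ) ^ 2 = p := Real.sq_sqrt hp'.le
    have hpp : (p : ℝ)⁻¹ * √p * ((p : ℝ)⁻¹ * √p) = (p : ℝ)⁻¹ := by
      calc _ = (p : ℝ)⁻¹ * ((p : ℝ)⁻¹ * √(p : ℝ) ^ 2) := by ring
        _ = _ := by rw [hs]; field_simp
    calc _ = (p : ℝ)⁻¹ * √p * ((p : ℝ)⁻¹ * √p) * (Bᵀ *ᵥ v) (Fin.castLE hdr i) ^ 2 := by ring
      _ = _ := by rw [hpp]
  rw [hH, ← div_eq_inv_mul, le_div_iff₀ hp']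
  nlinarith [mul_le_mul_of_nonneg_right (mul_le_mul_of_nonneg_left hη hp'.le) hxx]

end Leading

/-! ### Population second moments of factors, noise and predictor. -/

theorem abs_integral_mul_le_sqrt {Ω : Type*} [MeasurableSpace Ω] {μ : Measure Ω} {g h : Ω → ℝ}
    (hg : MemLp g 2 μ) (hh : MemLp h 2 μ) :
    |∫ ω, g ω * h ω ∂μ| ≤ √(∫ ω, g ω ^ 2 ∂μ) * √(∫ ω, h ω ^ 2 ∂μ) := by
  have hgh : Integrable (fun ω => g ω * h ω) μ := hg.integrable_mul hh
  -- The quadratic `t ↦ ∫ (t g + h)²` is nonnegative.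
  have hd : discrim (∫ ω, g ω ^ 2 ∂μ) (2 * ∫ ω, g ω * h ω ∂μ) (∫ ω, h ω ^ 2 ∂μ) ≤ 0 := by
    refine discrim_le_zero fun t => ?_
    have h0 : 0 ≤ ∫ ω, (t * g ω + h ω) ^ 2 ∂μ := integral_nonneg fun ω => sq_nonneg _
    have h1 : ∫ ω, (t * g ω + h ω) ^ 2 ∂μ =
        t ^ 2 * ∫ ω, g ω ^ 2 ∂μ + 2 * t * ∫ ω, g ω * h ω ∂μ + ∫ ω, h ω ^ 2 ∂μ := by
      rw [← integral_const_mul, ← integral_const_mul, ← integral_add, ← integral_add]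
      · exact integral_congr_ae (ae_of_all _ fun ω => by ring)
      · exact (hg.integrable_sq.const_mul _).add (hgh.const_mul _)
      · exact hh.integrable_sq
      · exact hg.integrable_sq.const_mul _
      · exact hgh.const_mul _
    rw [h1] at h0
    linarith
  rw [← Real.sqrt_mul (integral_nonneg fun ω => sq_nonneg _)]
  refine Real.abs_le_sqrt ?_
  rw [discrim] at hd
  linarith

section Population

variable {r p : ℕ} {P : Measure (FactorDraw r p)} {B : Matrix (Fin p) (Fin r) ℝ} {C₂ : ℝ}

/-- The second moment matrix `E(u uᵀ)` of the noise. -/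
noncomputable def noiseCov (P : Measure (FactorDraw r p)) : Matrix (Fin p) (Fin p) ℝ :=
  fun a b => ∫ z, z.2 a * z.2 b ∂P

/-- The second moment matrix `E(X Xᵀ)` of the predictor. -/
noncomputable def predictorCov (P : Measure (FactorDraw r p)) (B : Matrix (Fin p) (Fin r) ℝ) :
    Matrix (Fin p) (Fin p) ℝ :=
  fun a b => ∫ z, predictor B z a * predictor B z b ∂P

/-- The `L₂(P)` size of the noise in direction `x`. -/
noncomputable def noiseSize (P : Measure (FactorDraw r p)) (x : Fin p → ℝ) : ℝ :=
  √(∫ z, (x ⬝ᵥ z.2) ^ 2 ∂P)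

theorem noiseSize_nonneg (x : Fin p → ℝ) : 0 ≤ noiseSize P x := Real.sqrt_nonneg _

theorem noiseSize_sq (x : Fin p → ℝ) : noiseSize P x ^ 2 = ∫ z, (x ⬝ᵥ z.2) ^ 2 ∂P :=
  Real.sq_sqrt (integral_nonneg fun _ => sq_nonneg _)

theorem measurable_predictor : Measurable (predictor B) := by
  have h : Continuous (predictor B) := by
    unfold predictor
    fun_prop
  exact h.measurable

variable [IsProbabilityMeasure P]

theorem memLp_factor (hf : ∀ᵐ z ∂P, ∀ i, |z.1 i| ≤ C₂) (i : Fin r) :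
    MemLp (fun z : FactorDraw r p => z.1 i) 2 P :=
  MemLp.of_bound (by fun_prop) C₂ (hf.mono fun z hz => hz i)

theorem memLp_noise (hu : ∀ᵐ z ∂P, ∀ i, |z.2 i| ≤ C₂) (i : Fin p) :
    MemLp (fun z : FactorDraw r p => z.2 i) 2 P :=
  MemLp.of_bound (by fun_prop) C₂ (hu.mono fun z hz => hz i)

theorem memLp_dotProduct {ι Ω : Type*} [Fintype ι] [MeasurableSpace Ω] {μ : Measure Ω}
    {g : Ω → ι → ℝ} (hg : ∀ i, MemLp (fun ω => g ω i) 2 μ) (x : ι → ℝ) :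
    MemLp (fun ω => x ⬝ᵥ g ω) 2 μ := by
  simp only [dotProduct]
  exact memLp_finsetSum _ fun i _ => (hg i).const_mul (x i)

theorem integral_dotProduct_mul_dotProduct {ι Ω : Type*} [Fintype ι] [MeasurableSpace Ω]
    {μ : Measure Ω} {g : Ω → ι → ℝ} (hg : ∀ i, MemLp (fun ω => g ω i) 2 μ) (x y : ι → ℝ) :
    ∫ ω, (x ⬝ᵥ g ω) * (y ⬝ᵥ g ω) ∂μ =
      x ⬝ᵥ (Matrix.of fun a b => ∫ ω, g ω a * g ω b ∂μ) *ᵥ y := by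
  have hint : ∀ a b, Integrable (fun ω => x a * y b * (g ω a * g ω b)) μ := fun a b =>
    ((hg a).integrable_mul (hg b)).const_mul _
  have h1 : ∀ ω, (x ⬝ᵥ g ω) * (y ⬝ᵥ g ω) = ∑ a, ∑ b, x a * y b * (g ω a * g ω b) := fun ω => by
    rw [dotProduct, dotProduct, Finset.sum_mul_sum]
    exact Finset.sum_congr rfl fun a _ => Finset.sum_congr rfl fun b _ => by ring
  simp only [h1]
  rw [integral_finsetSum _ fun a _ => integrable_finsetSum _ fun b _ => hint a b]
  refine Finset.sum_congr rfl fun a _ => ?_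
  rw [integral_finsetSum _ fun b _ => hint a b, mulVec, dotProduct, Finset.mul_sum]
  refine Finset.sum_congr rfl fun b _ => ?_
  rw [integral_const_mul, of_apply]
  ring

theorem integral_factor_sq (hf : ∀ᵐ z ∂P, ∀ i, |z.1 i| ≤ C₂)
    (hcov : ∀ i j : Fin r, ∫ z, z.1 i * z.1 j ∂P = (1 : Matrix (Fin r) (Fin r) ℝ) i j)
    (x y : Fin r → ℝ) :
    ∫ z : FactorDraw r p, (x ⬝ᵥ z.1) * (y ⬝ᵥ z.1) ∂P = x ⬝ᵥ y := by
  rw [integral_dotProduct_mul_dotProduct (memLp_factor hf)]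
  have : (Matrix.of fun a b => ∫ z : FactorDraw r p, z.1 a * z.1 b ∂P) = 1 := by
    ext i j; exact hcov i j
  rw [this, one_mulVec]

theorem noiseSize_sq_eq (hu : ∀ᵐ z ∂P, ∀ i, |z.2 i| ≤ C₂) (x : Fin p → ℝ) :
    noiseSize P x ^ 2 = x ⬝ᵥ noiseCov P *ᵥ x := by
  rw [noiseSize_sq]
  have := integral_dotProduct_mul_dotProduct (memLp_noise hu) x x
  simp only [← sq] at this
  exact this

/-- In a direction with entries at most `K`, the quadratic form of the noise covariance is at most
`K²` times the sum of its absolute entries, the quantity that weak dependence keeps of order `p`. -/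
theorem noiseSize_le_of_bounded (hu : ∀ᵐ z ∂P, ∀ i, |z.2 i| ≤ C₂) {D K : ℝ} (hK : 0 ≤ K)
    (hD : ∑ a, ∑ b, |noiseCov P a b| ≤ D) {x : Fin p → ℝ} (hx : ∀ i, |x i| ≤ K) :
    noiseSize P x ≤ K * √D := by
  have hD0 : 0 ≤ D := le_trans (by positivity) hD
  refine abs_le_of_sq_le_sq' ?_ (by positivity) |>.2
  rw [noiseSize_sq_eq hu, mul_pow, Real.sq_sqrt hD0]
  refine le_trans ?_ (mul_le_mul_of_nonneg_left hD (sq_nonneg K))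
  simp only [dotProduct, mulVec, Finset.mul_sum]
  refine Finset.sum_le_sum fun a _ => Finset.sum_le_sum fun b _ => ?_
  refine (le_abs_self _).trans ?_
  rw [abs_mul, abs_mul]
  have h1 := mul_le_mul (hx a) (hx b) (abs_nonneg _) hK
  nlinarith [mul_le_mul_of_nonneg_right h1 (abs_nonneg (noiseCov P a b))]

theorem abs_noiseCov_le (hu : ∀ᵐ z ∂P, ∀ i, |z.2 i| ≤ C₂) (a b : Fin p) :
    |noiseCov P a b| ≤ C₂ ^ 2 := by
  have h : ∀ᵐ z ∂P, ‖z.2 a * z.2 b‖ ≤ C₂ ^ 2 := hu.mono fun z hz => by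
    rw [Real.norm_eq_abs, abs_mul, sq]
    exact mul_le_mul (hz a) (hz b) (abs_nonneg _) ((abs_nonneg _).trans (hz a))
  have := norm_integral_le_of_norm_le_const h
  rwa [probReal_univ, mul_one] at this

theorem sum_abs_noiseCov_le (hu : ∀ᵐ z ∂P, ∀ i, |z.2 i| ≤ C₂) {D : ℝ}
    (hD : ∑ j, ∑ j' ∈ Finset.univ.erase j, |∫ z, z.2 j * z.2 j' ∂P| ≤ D) :
    ∑ a, ∑ b, |noiseCov P a b| ≤ p * C₂ ^ 2 + D := by
  have h1 : ∀ a, ∑ b, |noiseCov P a b| =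
      |noiseCov P a a| + ∑ b ∈ Finset.univ.erase a, |noiseCov P a b| := fun a =>
    (Finset.add_sum_erase _ _ (Finset.mem_univ a)).symm
  simp only [h1, Finset.sum_add_distrib]
  refine add_le_add ?_ hD
  refine (Finset.sum_le_sum fun a _ => abs_noiseCov_le hu a a).trans ?_
  simp

/-- For arbitrary directions the Frobenius norm is used: its square is at most the largest entry `C₂
^ 2` times the entrywise sum `D`. With `D` of order `p` this is of order `√p`, negligible against
the signal `p`. -/
theorem noiseSize_sq_le (hu : ∀ᵐ z ∂P, ∀ i, |z.2 i| ≤ C₂) {D : ℝ}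
    (hD : ∑ a, ∑ b, |noiseCov P a b| ≤ D) (x : Fin p → ℝ) :
    noiseSize P x ^ 2 ≤ |C₂| * √D * (x ⬝ᵥ x) := by
  rw [noiseSize_sq_eq hu]
  refine (le_abs_self _).trans ((abs_bilin_le_frobNorm _ _ _).trans ?_)
  rw [← sq, euclNorm_sq]
  refine mul_le_mul_of_nonneg_right ?_ (dotProduct_self_nonneg_real x)
  have hD0 : 0 ≤ D := le_trans (by positivity) hD
  refine abs_le_of_sq_le_sq' ?_ (by positivity) |>.2
  rw [frobNorm_sq, mul_pow, Real.sq_sqrt hD0, sq_abs]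
  refine le_trans ?_ (mul_le_mul_of_nonneg_left hD (sq_nonneg C₂))
  simp only [Finset.mul_sum]
  refine Finset.sum_le_sum fun a _ => Finset.sum_le_sum fun b _ => ?_
  rw [← sq_abs, sq]
  exact mul_le_mul_of_nonneg_right (abs_noiseCov_le hu a b) (abs_nonneg _)

theorem dotProduct_predictor (x : Fin p → ℝ) (z : FactorDraw r p) :
    x ⬝ᵥ predictor B z = (Bᵀ *ᵥ x) ⬝ᵥ z.1 + x ⬝ᵥ z.2 := by
  rw [predictor, dotProduct_add, dotProduct_mulVec, ← mulVec_transpose]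

/-- Expanding `X = B f + u`, the factor–factor term is exactly `B Bᵀ`. The mixed terms need not
vanish, since `f` and `u` may be correlated; Cauchy–Schwarz bounds them. -/
theorem abs_bilin_predictorCov_sub_le (hf : ∀ᵐ z ∂P, ∀ i, |z.1 i| ≤ C₂)
    (hu : ∀ᵐ z ∂P, ∀ i, |z.2 i| ≤ C₂)
    (hcov : ∀ i j : Fin r, ∫ z, z.1 i * z.1 j ∂P = (1 : Matrix (Fin r) (Fin r) ℝ) i j)
    (x y : Fin p → ℝ) :
    |x ⬝ᵥ (predictorCov P B - B * Bᵀ) *ᵥ y| ≤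
      euclNorm (Bᵀ *ᵥ x) * noiseSize P y + noiseSize P x * euclNorm (Bᵀ *ᵥ y) +
        noiseSize P x * noiseSize P y := by
  have hF := fun v : Fin r → ℝ => memLp_dotProduct (memLp_factor hf) v
  have hU := fun v : Fin p → ℝ => memLp_dotProduct (memLp_noise hu) v
  have hX : ∀ a, MemLp (fun z => predictor B z a) 2 P := fun a => by
    have h := (hF (Bᵀ *ᵥ Pi.single a 1)).add (hU (Pi.single a 1))
    refine h.ae_eq (ae_of_all _ fun z => ?_)
    simp only [Pi.add_apply]
    rw [← dotProduct_predictor, single_one_dotProduct]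
  have hcs : ∀ v : Fin r → ℝ, √(∫ z : FactorDraw r p, (v ⬝ᵥ z.1) ^ 2 ∂P) = euclNorm v := fun v => by
    have := integral_factor_sq hf hcov v v
    simp only [← sq] at this
    rw [this, euclNorm]
  have h1 : x ⬝ᵥ predictorCov P B *ᵥ y =
      ∫ z, (x ⬝ᵥ predictor B z) * (y ⬝ᵥ predictor B z) ∂P :=
    (integral_dotProduct_mul_dotProduct hX x y).symm
  have h2 : x ⬝ᵥ (predictorCov P B - B * Bᵀ) *ᵥ y =
      ∫ z, ((Bᵀ *ᵥ x) ⬝ᵥ z.1) * (y ⬝ᵥ z.2) ∂P + ∫ z, (x ⬝ᵥ z.2) * ((Bᵀ *ᵥ y) ⬝ᵥ z.1) ∂P +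
        ∫ z, (x ⬝ᵥ z.2) * (y ⬝ᵥ z.2) ∂P := by
    rw [sub_mulVec, dotProduct_sub, bilin_loading, h1, sub_eq_iff_eq_add,
      ← integral_factor_sq hf hcov, ← integral_add, ← integral_add, ← integral_add]
    · refine integral_congr_ae (ae_of_all _ fun z => ?_)
      simp only [dotProduct_predictor]
      ring
    · exact (((hF _).integrable_mul (hU _)).add ((hU _).integrable_mul (hF _))).add
        ((hU _).integrable_mul (hU _))
    · exact (hF _).integrable_mul (hF _)
    · exact ((hF _).integrable_mul (hU _)).add ((hU _).integrable_mul (hF _))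
    · exact (hU _).integrable_mul (hU _)
    · exact (hF _).integrable_mul (hU _)
    · exact (hU _).integrable_mul (hF _)
  rw [h2]
  refine (abs_add_le _ _).trans (add_le_add ((abs_add_le _ _).trans (add_le_add ?_ ?_)) ?_)
  · rw [← hcs]; exact abs_integral_mul_le_sqrt (hF _) (hU _)
  · rw [← hcs]; exact abs_integral_mul_le_sqrt (hU _) (hF _)
  · exact abs_integral_mul_le_sqrt (hU _) (hU _)

end Population

/-! ### Mean square error of sample averages and of the sample covariance. -/

section Sampling

variable {ι α Ω : Type*} [MeasurableSpace α] [MeasurableSpace Ω] {P : Measure α} {μ : Measure Ω}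
  [IsProbabilityMeasure μ] {Z : ι → Ω → α} {T : Finset ι}

/-- The mean square error of the average of bounded i.i.d. variables. -/
theorem integral_sq_average_sub_le (hlaw : ∀ i, HasLaw (Z i) P μ) (hindep : iIndepFun Z μ)
    (hT : T.Nonempty) {g : α → ℝ} (hg : Measurable g) {L : ℝ} (hL : ∀ᵐ z ∂P, |g z| ≤ L) :
    ∫ ω, ((T.card : ℝ)⁻¹ * ∑ i ∈ T, g (Z i ω) - ∫ z, g z ∂P) ^ 2 ∂μ ≤ L ^ 2 / T.card := by
  have hm : (0 : ℝ) < T.card := by exact_mod_cast hT.card_pos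
  have hbd : ∀ i, ∀ᵐ ω ∂μ, |g (Z i ω)| ≤ L := fun i =>
    ae_of_ae_map (hlaw i).aemeasurable (by rwa [(hlaw i).map_eq])
  have hae : ∀ i, AEStronglyMeasurable (g ∘ Z i) μ := fun i =>
    (hg.comp_aemeasurable (hlaw i).aemeasurable).aestronglyMeasurable
  have hmem : ∀ i, MemLp (g ∘ Z i) 2 μ := fun i => MemLp.of_bound (hae i) L (hbd i)
  have hint : ∀ i, ∫ ω, (g ∘ Z i) ω ∂μ = ∫ z, g z ∂P := fun i =>
    (hlaw i).integral_comp hg.aestronglyMeasurable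
  have hvar : variance (∑ i ∈ T, g ∘ Z i) μ ≤ T.card * L ^ 2 := by
    rw [IndepFun.variance_sum (fun i _ => hmem i)
      (fun i _ j _ hij => (hindep.comp (fun _ => g) fun _ => hg).indepFun hij)]
    rw [← nsmul_eq_mul, ← Finset.sum_const]
    refine Finset.sum_le_sum fun i _ => (variance_le_expectation_sq (hae i)).trans ?_
    calc ∫ ω, ((g ∘ Z i) ^ 2) ω ∂μ ≤ ∫ _, L ^ 2 ∂μ := by
          refine integral_mono_ae (hmem i).integrable_sq (integrable_const _) ?_
          filter_upwards [hbd i] with ω hω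
          exact sq_le_sq' (abs_le.mp hω).1 (abs_le.mp hω).2
      _ = L ^ 2 := by simp
  have hmean : ∫ ω, (∑ i ∈ T, g ∘ Z i) ω ∂μ = T.card * ∫ z, g z ∂P := by
    simp only [Finset.sum_apply]
    rw [integral_finsetSum _ fun i _ => (hmem i).integrable one_le_two]
    rw [Finset.sum_congr rfl fun i _ => hint i, Finset.sum_const, nsmul_eq_mul]
  rw [variance_eq_integral (Finset.aemeasurable_sum _ fun i _ => (hae i).aemeasurable),
    hmean] at hvar
  have h1 : ∀ ω, ((T.card : ℝ)⁻¹ * ∑ i ∈ T, g (Z i ω) - ∫ z, g z ∂P) ^ 2 =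
      ((T.card : ℝ) ^ 2)⁻¹ * ((∑ i ∈ T, g ∘ Z i) ω - T.card * ∫ z, g z ∂P) ^ 2 := fun ω => by
    simp only [Finset.sum_apply, Function.comp]
    field_simp
  simp only [h1]
  rw [integral_const_mul]
  calc _ ≤ ((T.card : ℝ) ^ 2)⁻¹ * (T.card * L ^ 2) := by gcongr
    _ = _ := by field_simp

end Sampling

theorem sampleCov_apply {ι : Type*} {p : ℕ} {T : Finset ι} (hT : T.Nonempty)
    (x : ι → Fin p → ℝ) (a b : Fin p) :
    sampleCov T x a b = (T.card : ℝ)⁻¹ * ∑ i ∈ T, x i a * x i b -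
      ((T.card : ℝ)⁻¹ * ∑ i ∈ T, x i a) * ((T.card : ℝ)⁻¹ * ∑ i ∈ T, x i b) := by
  have hm : (T.card : ℝ) ≠ 0 := by exact_mod_cast hT.card_pos.ne'
  have hmean : ∀ a, sampleMean T x a = (T.card : ℝ)⁻¹ * ∑ i ∈ T, x i a := fun a => by
    simp [sampleMean]
  have h1 : ∀ i, vecMulVec (x i - sampleMean T x) (x i - sampleMean T x) a b =
      x i a * x i b - sampleMean T x b * x i a - sampleMean T x a * x i b +
        sampleMean T x a * sampleMean T x b := fun i => by
    simp only [vecMulVec_apply, Pi.sub_apply]; ring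
  rw [sampleCov, Matrix.smul_apply, Matrix.sum_apply, smul_eq_mul]
  simp only [h1, Finset.sum_add_distrib, Finset.sum_sub_distrib, ← Finset.mul_sum,
    Finset.sum_const, nsmul_eq_mul, hmean]
  field_simp
  ring

section PredictorSample

variable {ι Ω : Type*} [MeasurableSpace Ω] {r p : ℕ} {P : Measure (FactorDraw r p)}
  {μ : Measure Ω} {Z : ι → Ω → FactorDraw r p} {T : Finset ι}
  {B : Matrix (Fin p) (Fin r) ℝ} {K : ℝ}

theorem measurable_predictor_apply (a : Fin p) : Measurable fun z => predictor B z a :=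
  (measurable_pi_apply a).comp measurable_predictor

theorem aemeasurable_sampleCov_sub (hlaw : ∀ i, HasLaw (Z i) P μ) (hT : T.Nonempty)
    (Γ : Matrix (Fin p) (Fin p) ℝ) (a b : Fin p) :
    AEMeasurable (fun ω => (sampleCov T (fun i => predictor B (Z i ω)) - Γ) a b) μ := by
  have hX : ∀ i a, AEMeasurable (fun ω => predictor B (Z i ω) a) μ := fun i a =>
    (measurable_predictor_apply a).comp_aemeasurable (hlaw i).aemeasurable
  simp only [Matrix.sub_apply, sampleCov_apply hT]
  fun_prop

variable [IsProbabilityMeasure μ]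

/-- Entrywise mean square error of the sample covariance matrix. -/
theorem integral_sq_sampleCov_sub_le (hlaw : ∀ i, HasLaw (Z i) P μ) (hindep : iIndepFun Z μ)
    (hT : T.Nonempty) (hX : ∀ᵐ z ∂P, ∀ a, |predictor B z a| ≤ K)
    (hmean : ∀ a, ∫ z, predictor B z a ∂P = 0) (a b : Fin p) :
    Integrable
      (fun ω => (sampleCov T (fun i => predictor B (Z i ω)) - predictorCov P B) a b ^ 2) μ ∧
    ∫ ω, (sampleCov T (fun i => predictor B (Z i ω)) - predictorCov P B) a b ^ 2 ∂μ ≤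
      4 * K ^ 4 / T.card := by
  have hm : (0 : ℝ) < T.card := by exact_mod_cast hT.card_pos
  have hmeasX := measurable_predictor_apply (B := B)
  have hZ : ∀ i, AEMeasurable (Z i) μ := fun i => (hlaw i).aemeasurable
  have hXae : ∀ i a, AEMeasurable (fun ω => predictor B (Z i ω) a) μ := fun i a =>
    (hmeasX a).comp_aemeasurable (hZ i)
  have hbdall : ∀ᵐ ω ∂μ, ∀ i ∈ T, ∀ a, |predictor B (Z i ω) a| ≤ K := by
    rw [Finset.eventually_all]
    intro i _
    exact ae_of_ae_map (hZ i) (by rwa [(hlaw i).map_eq])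
  have avg_le : ∀ {L : ℝ} {y : ι → ℝ}, (∀ i ∈ T, |y i| ≤ L) →
      |(T.card : ℝ)⁻¹ * ∑ i ∈ T, y i| ≤ L := fun {L y} hy => by
    rw [abs_mul, abs_of_pos (inv_pos.mpr hm), inv_mul_le_iff₀ hm, ← nsmul_eq_mul]
    exact (Finset.abs_sum_le_sum_abs _ _).trans (Finset.sum_le_card_nsmul _ _ _ hy)
  let U : Ω → ℝ := fun ω => (T.card : ℝ)⁻¹ * ∑ i ∈ T, predictor B (Z i ω) a * predictor B (Z i ω) b
    - predictorCov P B a b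
  let M : Fin p → Ω → ℝ := fun a ω => (T.card : ℝ)⁻¹ * ∑ i ∈ T, predictor B (Z i ω) a
  have hUae : AEMeasurable U μ := by fun_prop
  have hMae : ∀ a, AEMeasurable (M a) μ := fun a => by fun_prop
  have hMK : ∀ᵐ ω ∂μ, ∀ a, |M a ω| ≤ K := hbdall.mono fun ω hω a => avg_le fun i hi => hω i hi a
  have hUb : ∀ᵐ ω ∂μ, ‖U ω‖ ≤ K ^ 2 + |predictorCov P B a b| := hbdall.mono fun ω hω => by
    refine (abs_sub _ _).trans (add_le_add (avg_le fun i hi => ?_) le_rfl)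
    rw [abs_mul, sq]
    exact mul_le_mul (hω i hi a) (hω i hi b) (abs_nonneg _) ((abs_nonneg _).trans (hω i hi a))
  have hU2 : Integrable (fun ω => U ω ^ 2) μ :=
    (MemLp.of_bound hUae.aestronglyMeasurable _ hUb).integrable_sq
  have hM2 : Integrable (fun ω => M b ω ^ 2) μ :=
    (MemLp.of_bound (hMae b).aestronglyMeasurable K (hMK.mono fun ω h => h b)).integrable_sq
  -- The entry error is `U - M a * M b`. In the centering term one mean is bounded by `K` and only
  -- the other needs to be small in mean square, so no fourth moment of an average enters.
  have hle : ∀ᵐ ω ∂μ, (sampleCov T (fun i => predictor B (Z i ω)) - predictorCov P B) a b ^ 2 ≤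
      2 * U ω ^ 2 + 2 * K ^ 2 * M b ω ^ 2 := hMK.mono fun ω hω => by
    have h1 : (sampleCov T (fun i => predictor B (Z i ω)) - predictorCov P B) a b =
        U ω - M a ω * M b ω := by
      rw [Matrix.sub_apply, sampleCov_apply hT]; simp only [U, M]; ring
    have h2 : M a ω ^ 2 ≤ K ^ 2 := sq_le_sq' (abs_le.mp (hω a)).1 (abs_le.mp (hω a)).2
    rw [h1]
    nlinarith [mul_le_mul_of_nonneg_right h2 (sq_nonneg (M b ω)),
      sq_nonneg (U ω + M a ω * M b ω)]
  have hdom : Integrable (fun ω => 2 * U ω ^ 2 + 2 * K ^ 2 * M b ω ^ 2) μ :=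
    (hU2.const_mul _).add (hM2.const_mul _)
  have hint : Integrable
      (fun ω => (sampleCov T (fun i => predictor B (Z i ω)) - predictorCov P B) a b ^ 2) μ := by
    refine hdom.mono' ((aemeasurable_sampleCov_sub hlaw hT _ a b).pow_const
      2).aestronglyMeasurable (hle.mono fun ω hω => ?_)
    rwa [Real.norm_of_nonneg (sq_nonneg _)]
  refine ⟨hint, ?_⟩
  have hEU : ∫ ω, U ω ^ 2 ∂μ ≤ (K ^ 2) ^ 2 / T.card :=
    integral_sq_average_sub_le (g := fun z => predictor B z a * predictor B z b) hlaw hindep hT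
      ((hmeasX a).mul (hmeasX b)) (hX.mono fun z hz => by
        rw [abs_mul, sq]
        exact mul_le_mul (hz a) (hz b) (abs_nonneg _) ((abs_nonneg _).trans (hz a)))
  have hEM : ∫ ω, M b ω ^ 2 ∂μ ≤ K ^ 2 / T.card := by
    have := integral_sq_average_sub_le (g := fun z => predictor B z b) hlaw hindep hT (hmeasX b)
      (hX.mono fun z hz => hz b)
    simpa only [hmean, sub_zero] using this
  calc _ ≤ ∫ ω, (2 * U ω ^ 2 + 2 * K ^ 2 * M b ω ^ 2) ∂μ := integral_mono_ae hint hdom hle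
    _ = 2 * ∫ ω, U ω ^ 2 ∂μ + 2 * K ^ 2 * ∫ ω, M b ω ^ 2 ∂μ := by
      rw [integral_add (hU2.const_mul _) (hM2.const_mul _), integral_const_mul, integral_const_mul]
    _ ≤ 2 * ((K ^ 2) ^ 2 / T.card) + 2 * K ^ 2 * (K ^ 2 / T.card) := by gcongr
    _ = _ := by ring

/-- Tail bound for the Frobenius error of the sample covariance matrix. -/
theorem measure_frobNorm_sampleCov_sub_le (hlaw : ∀ i, HasLaw (Z i) P μ) (hindep : iIndepFun Z μ)
    (hT : T.Nonempty) (hX : ∀ᵐ z ∂P, ∀ a, |predictor B z a| ≤ K)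
    (hmean : ∀ a, ∫ z, predictor B z a ∂P = 0) (hp : 0 < p) {τ : ℝ} (hτ : 0 < τ) :
    μ {ω | p * τ < frobNorm (sampleCov T (fun i => predictor B (Z i ω)) - predictorCov P B)} ≤
      ENNReal.ofReal (4 * K ^ 4 / (T.card * τ ^ 2)) := by
  have hm : (0 : ℝ) < T.card := by exact_mod_cast hT.card_pos
  have hp' : (0 : ℝ) < p := by exact_mod_cast hp
  have hentry := integral_sq_sampleCov_sub_le (B := B) hlaw hindep hT hX hmean
  set D : Ω → Matrix (Fin p) (Fin p) ℝ := fun ω =>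
    sampleCov T (fun i => predictor B (Z i ω)) - predictorCov P B with hD
  have hint : Integrable (fun ω => ∑ a, ∑ b, D ω a b ^ 2) μ :=
    integrable_finsetSum _ fun a _ => integrable_finsetSum _ fun b _ => (hentry a b).1
  have hE : ∫ ω, ∑ a, ∑ b, D ω a b ^ 2 ∂μ ≤ p ^ 2 * (4 * K ^ 4 / T.card) := by
    rw [integral_finsetSum _ fun a _ => integrable_finsetSum _ fun b _ => (hentry a b).1]
    simp only [integral_finsetSum _ fun b _ => (hentry _ b).1]
    refine (Finset.sum_le_sum fun a _ => Finset.sum_le_sum fun b _ => (hentry a b).2).trans ?_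
    simp only [Finset.sum_const, Finset.card_univ, Fintype.card_fin, nsmul_eq_mul]
    apply le_of_eq; ring
  have hmarkov := mul_meas_ge_le_integral_of_nonneg (ae_of_all μ fun ω =>
    Finset.sum_nonneg fun a _ => Finset.sum_nonneg fun b _ => sq_nonneg (D ω a b)) hint
    ((p * τ) ^ 2)
  have hreal : μ.real {ω | (p * τ) ^ 2 ≤ ∑ a, ∑ b, D ω a b ^ 2} ≤
      4 * K ^ 4 / (T.card * τ ^ 2) := by
    have h0 : (0 : ℝ) < (p * τ) ^ 2 := by positivity
    refine le_of_mul_le_mul_left ((hmarkov.trans hE).trans (le_of_eq ?_)) h0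
    field_simp
  refine (measure_mono fun ω hω => ?_).trans
    ((ENNReal.le_ofReal_iff_toReal_le (measure_ne_top μ _) (by positivity)).mpr hreal)
  have h : p * τ < frobNorm (D ω) := hω
  change (p * τ) ^ 2 ≤ ∑ a, ∑ b, D ω a b ^ 2
  rw [← frobNorm_sq]
  exact pow_le_pow_left₀ (by positivity) h.le 2

end PredictorSample

/-- Passing to an integrable majorant `G` means that no measurability of `F` has to be checked. -/
theorem eLpNorm_two_le_of_sq_le {Ω E : Type*} [MeasurableSpace Ω] [NormedAddCommGroup E]
    {μ : Measure Ω} {F : Ω → E} {G : Ω → ℝ} (hG : Integrable G μ) (hFG : ∀ ω, ‖F ω‖ ^ 2 ≤ G ω)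
    {b : ℝ} (hb : 0 ≤ b) (hGb : ∫ ω, G ω ∂μ ≤ b ^ 2) : eLpNorm F 2 μ ≤ ENNReal.ofReal b := by
  rw [eLpNorm_eq_lintegral_rpow_enorm_toReal (by norm_num) (by norm_num)]
  simp only [ENNReal.toReal_ofNat]
  have h1 : ∫⁻ ω, ‖F ω‖ₑ ^ (2 : ℝ) ∂μ ≤ ENNReal.ofReal (b ^ 2) := by
    calc ∫⁻ ω, ‖F ω‖ₑ ^ (2 : ℝ) ∂μ ≤ ∫⁻ ω, ENNReal.ofReal (G ω) ∂μ := by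
          refine lintegral_mono fun ω => ?_
          rw [← ofReal_norm, ENNReal.ofReal_rpow_of_nonneg (norm_nonneg _) zero_le_two]
          refine ENNReal.ofReal_le_ofReal ?_
          rw [Real.rpow_two]; exact hFG ω
      _ = ENNReal.ofReal (∫ ω, G ω ∂μ) := (ofReal_integral_eq_lintegral_ofReal hG
          (ae_of_all _ fun ω => (sq_nonneg _).trans (hFG ω))).symm
      _ ≤ _ := ENNReal.ofReal_le_ofReal hGb
  calc _ ≤ (ENNReal.ofReal (b ^ 2)) ^ (1 / (2 : ℝ)) :=
        ENNReal.rpow_le_rpow h1 (by norm_num)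
    _ = ENNReal.ofReal b := by
        rw [ENNReal.ofReal_rpow_of_nonneg (sq_nonneg b) (by norm_num), ← Real.sqrt_eq_rpow,
          Real.sqrt_sq hb]

/-! ### The representation error in terms of overlaps and noise. -/

section Representation

variable {p k r d : ℕ} {P : Measure (FactorDraw r p)} [IsProbabilityMeasure P]
  {B : Matrix (Fin p) (Fin r) ℝ} {V : Matrix (Fin p) (Fin k) ℝ} {C₂ : ℝ}

/-- The part of `R̂_{[d]}` that is not explained by `H_d f_{[d]}`. -/
theorem pcaRep_sub_pcaH_apply (hk : d ≤ k) (hr : d ≤ r) (z : FactorDraw r p) (i : Fin d) :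
    (firstCoords hk (pcaRep (pcaW V) (predictor B z)) -
      pcaH hk hr (pcaW V) B *ᵥ firstCoords hr z.1) i = (p : ℝ)⁻¹ * √p *
      ((fun j : Fin r => if d ≤ j.1 then B.col j ⬝ᵥ V.col (Fin.castLE hk i) else 0) ⬝ᵥ z.1 +
        V.col (Fin.castLE hk i) ⬝ᵥ z.2) := by
  have h1 : firstCoords hk (pcaRep (pcaW V) (predictor B z)) i =
      (p : ℝ)⁻¹ * √p * (V.col (Fin.castLE hk i) ⬝ᵥ predictor B z) := by
    rw [firstCoords, pcaRep, pcaW, transpose_smul, smul_mulVec, smul_smul]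
    rfl
  have h2 : (pcaH hk hr (pcaW V) B *ᵥ firstCoords hr z.1) i =
      (p : ℝ)⁻¹ * √p * ∑ l : Fin d, (B.col (Fin.castLE hr l) ⬝ᵥ V.col (Fin.castLE hk i)) *
        z.1 (Fin.castLE hr l) := by
    have h : firstCols hk (pcaW V) = √p • firstCols hk V := rfl
    rw [pcaH, h, transpose_smul, Matrix.smul_mul, smul_smul, smul_mulVec, Pi.smul_apply, smul_eq_mul]
    congr 1
    change ∑ l, ((firstCols hk V)ᵀ * firstCols hr B) i l * z.1 (Fin.castLE hr l) = _
    refine Finset.sum_congr rfl fun l _ => ?_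
    rw [dotProduct_comm (B.col _)]
    rfl
  rw [Pi.sub_apply, h1, h2, dotProduct_predictor, ← mul_sub]
  congr 1
  have h3 : (Bᵀ *ᵥ V.col (Fin.castLE hk i)) ⬝ᵥ z.1 =
      ∑ j, (B.col j ⬝ᵥ V.col (Fin.castLE hk i)) * z.1 j := rfl
  rw [h3, sum_eq_sum_castLE_add hr, Finset.sum_filter]
  simp only [dotProduct, ite_mul, zero_mul]
  ring

/-- The error equals `H⁻¹ g` with `g` the residual `R̂_{[d]} - H f_{[d]}`, so the lower bound on `H`
gives `‖H⁻¹ g‖² ≤ a⁻¹ ‖g‖²`. The factor `2` separates the factor part of `g` from the noise part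
without using any relation between them. -/
theorem reprError_le (hk : d ≤ k) (hr : d ≤ r) (hp : 0 < p)
    (hf : ∀ᵐ z ∂P, ∀ i, |z.1 i| ≤ C₂) (hu : ∀ᵐ z ∂P, ∀ i, |z.2 i| ≤ C₂)
    (hcov : ∀ i j : Fin r, ∫ z, z.1 i * z.1 j ∂P = (1 : Matrix (Fin r) (Fin r) ℝ) i j)
    {a : ℝ} (ha : 0 < a) (hH : IsUnit (pcaH hk hr (pcaW V) B))
    (hlow : ∀ y, a * (y ⬝ᵥ y) ≤
      (pcaH hk hr (pcaW V) B *ᵥ y) ⬝ᵥ (pcaH hk hr (pcaW V) B *ᵥ y))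
    {s t : ℝ}
    (hs : ∀ (i : Fin d) (j : Fin r), d ≤ j.1 → (B.col j ⬝ᵥ V.col (Fin.castLE hk i)) ^ 2 ≤ s)
    (hs0 : 0 ≤ s) (ht0 : 0 ≤ t)
    (ht : ∀ i : Fin d, noiseSize P (V.col (Fin.castLE hk i)) ^ 2 ≤ t) :
    reprError hk hr P B (pcaW V) (pcaH hk hr (pcaW V) B)⁻¹ ≤
      ENNReal.ofReal √(a⁻¹ * (d * (2 * (p : ℝ)⁻¹ * (r * s + t)))) := by
  have hp' : (0 : ℝ) < p := by exact_mod_cast hp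
  set H := pcaH hk hr (pcaW V) B with hHdef
  have hdet : IsUnit H.det := (isUnit_iff_isUnit_det H).mp hH
  let w : Fin d → Fin r → ℝ := fun i j =>
    if d ≤ j.1 then B.col j ⬝ᵥ V.col (Fin.castLE hk i) else 0
  let v : Fin d → Fin p → ℝ := fun i => V.col (Fin.castLE hk i)
  have hF := fun x : Fin r → ℝ => (memLp_dotProduct (memLp_factor hf) x).integrable_sq
  have hU := fun x : Fin p → ℝ => (memLp_dotProduct (memLp_noise hu) x).integrable_sq
  have hww : ∀ i, w i ⬝ᵥ w i ≤ r * s := fun i => by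
    have : ∀ j ∈ Finset.univ, w i j * w i j ≤ s := fun j _ => by
      by_cases hj : d ≤ j.1
      · simpa [w, hj, ← sq] using hs i j hj
      · simpa [w, hj] using hs0
    simpa [dotProduct] using Finset.sum_le_card_nsmul _ _ _ this
  let G : FactorDraw r p → ℝ := fun z =>
    a⁻¹ * ∑ i, 2 * (p : ℝ)⁻¹ * ((w i ⬝ᵥ z.1) ^ 2 + (v i ⬝ᵥ z.2) ^ 2)
  have hterm : ∀ i, Integrable
      (fun z : FactorDraw r p => 2 * (p : ℝ)⁻¹ * ((w i ⬝ᵥ z.1) ^ 2 + (v i ⬝ᵥ z.2) ^ 2)) P :=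
    fun i => ((hF _).add (hU _)).const_mul _
  have hG : Integrable G P := (integrable_finsetSum _ fun i _ => hterm i).const_mul _
  refine eLpNorm_two_le_of_sq_le hG (fun z => ?_) (Real.sqrt_nonneg _) ?_
  · set g := firstCoords hk (pcaRep (pcaW V) (predictor B z)) - H *ᵥ firstCoords hr z.1 with hg
    have hy : H⁻¹ *ᵥ firstCoords hk (pcaRep (pcaW V) (predictor B z)) - firstCoords hr z.1 =
        H⁻¹ *ᵥ g := by
      rw [hg, mulVec_sub, mulVec_mulVec, nonsing_inv_mul _ hdet, one_mulVec]
    have h1 := hlow (H⁻¹ *ᵥ g)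
    rw [mulVec_mulVec, mul_nonsing_inv _ hdet, one_mulVec] at h1
    rw [hy, EuclideanSpace.real_norm_sq_eq]
    have h2 : ∑ i, (WithLp.toLp 2 (H⁻¹ *ᵥ g)) i ^ 2 = (H⁻¹ *ᵥ g) ⬝ᵥ (H⁻¹ *ᵥ g) :=
      Finset.sum_congr rfl fun i _ => sq _
    rw [h2]
    refine (le_inv_mul_iff₀ ha).mpr (h1.trans (Finset.sum_le_sum fun i _ => ?_))
    rw [hg, hHdef, pcaRep_sub_pcaH_apply]
    change (p : ℝ)⁻¹ * √p * (w i ⬝ᵥ z.1 + v i ⬝ᵥ z.2) *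
      ((p : ℝ)⁻¹ * √p * (w i ⬝ᵥ z.1 + v i ⬝ᵥ z.2)) ≤ _
    have hpp : (p : ℝ)⁻¹ * √p * ((p : ℝ)⁻¹ * √p) = (p : ℝ)⁻¹ := by
      calc _ = (p : ℝ)⁻¹ * ((p : ℝ)⁻¹ * (√(p : ℝ) * √(p : ℝ))) := by ring
        _ = _ := by rw [Real.mul_self_sqrt hp'.le]; field_simp
    calc _ = (p : ℝ)⁻¹ * √p * ((p : ℝ)⁻¹ * √p) * (w i ⬝ᵥ z.1 + v i ⬝ᵥ z.2) ^ 2 := by ring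
      _ = (p : ℝ)⁻¹ * (w i ⬝ᵥ z.1 + v i ⬝ᵥ z.2) ^ 2 := by rw [hpp]
      _ ≤ (p : ℝ)⁻¹ * (2 * ((w i ⬝ᵥ z.1) ^ 2 + (v i ⬝ᵥ z.2) ^ 2)) := by
        gcongr; exact add_sq_le
      _ = _ := by ring
  · have hnn : 0 ≤ a⁻¹ * (d * (2 * (p : ℝ)⁻¹ * (r * s + t))) := by positivity
    rw [Real.sq_sqrt hnn, integral_const_mul, integral_finsetSum _ fun i _ => hterm i]
    refine mul_le_mul_of_nonneg_left ?_ (inv_nonneg.mpr ha.le)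
    have hi : ∀ i ∈ Finset.univ, ∫ z, 2 * (p : ℝ)⁻¹ * ((w i ⬝ᵥ z.1) ^ 2 + (v i ⬝ᵥ z.2) ^ 2) ∂P ≤
        2 * (p : ℝ)⁻¹ * (r * s + t) := fun i _ => by
      rw [integral_const_mul, integral_add (hF _) (hU _), ← noiseSize_sq]
      have := integral_factor_sq hf hcov (w i) (w i)
      simp only [← sq] at this
      rw [this]
      have h1 := hww i
      have h2 := ht i
      gcongr
    simpa using Finset.sum_le_card_nsmul _ _ _ hi

end Representation

/-! ### Crude and sharp bounds on `S - B Bᵀ`, and the deterministic error bound. -/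

section Perturbation

variable {p k r d : ℕ} {P : Measure (FactorDraw r p)} [IsProbabilityMeasure P]
  {S : Matrix (Fin p) (Fin p) ℝ} {B : Matrix (Fin p) (Fin r) ℝ} {V : Matrix (Fin p) (Fin k) ℝ}
  {μ : Fin r → ℝ} {c C C₁ C₂ C₃ D τ θ : ℝ}

/-- The bound is immediate for `B`, whose Gram matrix is diagonal, and passes to `Bᵀ` through `‖Bᵀ
x‖² = ⟨x, B Bᵀ x⟩`. -/
theorem euclNorm_transpose_mulVec_le (hB : Bᵀ * B = diagonal fun j => (p : ℝ) * μ j)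
    (hμC : ∀ j, μ j ≤ C) (hC : 0 ≤ C) (x : Fin p → ℝ) :
    euclNorm (Bᵀ *ᵥ x) ≤ √C * √p * euclNorm x := by
  set w := Bᵀ *ᵥ x with hw
  have h1 : w ⬝ᵥ w = x ⬝ᵥ (B *ᵥ w) := by
    rw [dotProduct_mulVec x B w, ← mulVec_transpose, ← hw]
  have h2 : euclNorm (B *ᵥ w) ≤ √C * √p * euclNorm w := by
    refine abs_le_of_sq_le_sq' ?_ (mul_nonneg (by positivity) (euclNorm_nonneg _)) |>.2
    rw [mul_pow, mul_pow, Real.sq_sqrt hC, Real.sq_sqrt (Nat.cast_nonneg p), euclNorm_sq,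
      euclNorm_sq, dotProduct_mulVec, ← mulVec_transpose, transpose_mulVec_mulVec hB,
      dotProduct, dotProduct, Finset.mul_sum]
    refine Finset.sum_le_sum fun j _ => ?_
    have := mul_le_mul_of_nonneg_left (hμC j)
      (mul_nonneg (Nat.cast_nonneg (α := ℝ) p) (mul_self_nonneg (w j)))
    linarith
  have h3 := abs_dotProduct_le x (B *ᵥ w)
  rw [← h1, abs_of_nonneg (dotProduct_self_nonneg_real w), ← euclNorm_sq, sq] at h3
  rcases (euclNorm_nonneg w).eq_or_lt with h0 | hpos
  · rw [← h0]
    exact mul_nonneg (by positivity) (euclNorm_nonneg x)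
  · refine le_of_mul_le_mul_right (h3.trans ?_) hpos
    nlinarith [mul_le_mul_of_nonneg_left h2 (euclNorm_nonneg x)]

theorem abs_bilin_error_le (hf : ∀ᵐ z ∂P, ∀ i, |z.1 i| ≤ C₂)
    (hu : ∀ᵐ z ∂P, ∀ i, |z.2 i| ≤ C₂)
    (hcov : ∀ i j : Fin r, ∫ z, z.1 i * z.1 j ∂P = (1 : Matrix (Fin r) (Fin r) ℝ) i j)
    (hS : frobNorm (S - predictorCov P B) ≤ p * τ) (x y : Fin p → ℝ) :
    |x ⬝ᵥ (S - B * Bᵀ) *ᵥ y| ≤ p * τ * (euclNorm x * euclNorm y) +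
      (euclNorm (Bᵀ *ᵥ x) * noiseSize P y + noiseSize P x * euclNorm (Bᵀ *ᵥ y) +
        noiseSize P x * noiseSize P y) := by
  have h : S - B * Bᵀ = (S - predictorCov P B) + (predictorCov P B - B * Bᵀ) := by abel
  rw [h, add_mulVec, dotProduct_add]
  refine (abs_add_le _ _).trans (add_le_add ?_ (abs_bilin_predictorCov_sub_le hf hu hcov x y))
  exact (abs_bilin_le_frobNorm _ _ _).trans (mul_le_mul_of_nonneg_right hS
    (mul_nonneg (euclNorm_nonneg x) (euclNorm_nonneg y)))

/-- The crude bound, valid in all directions. In the application `θ` is of order `p^{-1/2}`, so the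
`√θ` term decays only like `p^{-1/4}`; it serves for the gap and for `H_d`, never for the final
rate. -/
theorem abs_bilin_error_le_opNorm (hf : ∀ᵐ z ∂P, ∀ i, |z.1 i| ≤ C₂)
    (hu : ∀ᵐ z ∂P, ∀ i, |z.2 i| ≤ C₂)
    (hcov : ∀ i j : Fin r, ∫ z, z.1 i * z.1 j ∂P = (1 : Matrix (Fin r) (Fin r) ℝ) i j)
    (hS : frobNorm (S - predictorCov P B) ≤ p * τ)
    (hB : Bᵀ * B = diagonal fun j => (p : ℝ) * μ j) (hμC : ∀ j, μ j ≤ C) (hC : 0 ≤ C)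
    (hθ0 : 0 ≤ θ) (hθ : ∀ x, noiseSize P x ^ 2 ≤ p * θ * (x ⬝ᵥ x)) (x y : Fin p → ℝ) :
    |x ⬝ᵥ (S - B * Bᵀ) *ᵥ y| ≤
      p * (τ + 2 * √C * √θ + θ) * (euclNorm x * euclNorm y) := by
  have hs : ∀ x, noiseSize P x ≤ √p * √θ * euclNorm x := fun x => by
    refine abs_le_of_sq_le_sq' ?_ (mul_nonneg (by positivity) (euclNorm_nonneg x)) |>.2
    rw [mul_pow, mul_pow, Real.sq_sqrt hθ0, Real.sq_sqrt (Nat.cast_nonneg p), euclNorm_sq]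
    exact hθ x
  have ht := euclNorm_transpose_mulVec_le hB hμC hC
  refine (abs_bilin_error_le hf hu hcov hS x y).trans ?_
  have hx := euclNorm_nonneg x
  have hy := euclNorm_nonneg y
  have h1 := mul_le_mul (ht x) (hs y) (noiseSize_nonneg y) (mul_nonneg (by positivity) hx)
  have h2 := mul_le_mul (hs x) (ht y) (euclNorm_nonneg _) (mul_nonneg (by positivity) hx)
  have h3 := mul_le_mul (hs x) (hs y) (noiseSize_nonneg y) (mul_nonneg (by positivity) hx)
  have hpp : √(p : ℝ) * √(p : ℝ) = p := Real.mul_self_sqrt (Nat.cast_nonneg p)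
  have hθθ : √θ * √θ = θ := Real.mul_self_sqrt hθ0
  calc _ ≤ p * τ * (euclNorm x * euclNorm y) + (√C * √p * euclNorm x * (√p * √θ * euclNorm y) +
        √p * √θ * euclNorm x * (√C * √p * euclNorm y) +
        √p * √θ * euclNorm x * (√p * √θ * euclNorm y)) := by linarith
    _ = p * τ * (euclNorm x * euclNorm y) + (√p * √p) * (2 * √C * √θ + √θ * √θ) *
        (euclNorm x * euclNorm y) := by ring
    _ = _ := by rw [hpp, hθθ]; ring

/-- On the event where the sample covariance matrix is close to its population version and the
projection matrix is bounded, `H_d` is invertible and the representation error is small. -/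
theorem IsLeadingEigenvectors.isUnit_pcaH_and_reprError_le (hV : IsLeadingEigenvectors S V)
    (hp : 0 < p) (hrk : r ≤ k) (hdr : d < r)
    (hf : ∀ᵐ z ∂P, ∀ i, |z.1 i| ≤ C₂) (hu : ∀ᵐ z ∂P, ∀ i, |z.2 i| ≤ C₂)
    (hcov : ∀ i j : Fin r, ∫ z, z.1 i * z.1 j ∂P = (1 : Matrix (Fin r) (Fin r) ℝ) i j)
    (hB : Bᵀ * B = diagonal fun j => (p : ℝ) * μ j) (hc : 0 < c)
    (hμ : ∀ j, c ≤ μ j) (hμC : ∀ j, μ j ≤ C) (hgap : ∀ i j, i < j → c ≤ μ i - μ j)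
    (hC₁ : 0 ≤ C₁) (hBb : ∀ i j, |B i j| ≤ C₁) (hC₃ : 0 ≤ C₃) (hW : ∀ i j, |pcaW V i j| ≤ C₃)
    (hD : 0 ≤ D) (hnoise : ∑ a, ∑ b, |noiseCov P a b| ≤ D * p)
    (hτ : 0 ≤ τ) (hS : frobNorm (S - predictorCov P B) ≤ p * τ)
    (hθ0 : 0 ≤ θ) (hθ : ∀ x, noiseSize P x ^ 2 ≤ p * θ * (x ⬝ᵥ x))
    (hη : τ + 2 * √C * √θ + θ ≤ c / 8)
    (hη2 : r ^ 2 * C * (τ + 2 * √C * √θ + θ) ^ 2 ≤ c ^ 3 / 16) :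
    IsUnit (pcaH (hdr.le.trans hrk) hdr.le (pcaW V) B) ∧
      reprError (hdr.le.trans hrk) hdr.le P B (pcaW V)
        (pcaH (hdr.le.trans hrk) hdr.le (pcaW V) B)⁻¹ ≤
      ENNReal.ofReal √(4 * d / c * (4 * r / c ^ 2 * (√C * τ +
        (C * C₃ * √D + C₁ * √D * √C + C₁ * C₃ * D) * (√p)⁻¹) ^ 2 +
        C₃ ^ 2 * D * (√p)⁻¹ ^ 2)) := by
  have hp' : (0 : ℝ) < p := by exact_mod_cast hp
  have hsp : 0 < √(p : ℝ) := Real.sqrt_pos.mpr hp'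
  have hpp : √(p : ℝ) ^ 2 = p := Real.sq_sqrt hp'.le
  have hC : 0 ≤ C := hc.le.trans ((hμ ⟨d, hdr⟩).trans (hμC _))
  have hop := abs_bilin_error_le_opNorm hf hu hcov hS hB hμC hC hθ0 hθ
  obtain ⟨hunit, hlow⟩ := isUnit_of_transpose_lower
    (pcaH (hdr.le.trans hrk) hdr.le (pcaW V) B) (half_pos hc)
    (hV.pcaH_lower hp hrk hdr.le hB hc hμ hμC hgap hop hη hη2)
  refine ⟨hunit, ?_⟩
  have hVnorm : ∀ i, euclNorm (V.col i) = 1 := fun i => by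
    rw [euclNorm, hV.col_dotProduct_self, Real.sqrt_one]
  -- Entries of `v_i` are at most `C₃ / √p`, which cancels the growth `√(D p)` of the flat-direction
  -- bound.
  have hVs : ∀ i, noiseSize P (V.col i) ≤ C₃ * √D := fun i => by
    have hb : ∀ a, |V.col i a| ≤ C₃ / √p := fun a => by
      rw [le_div_iff₀ hsp]
      have := hW a i
      rw [pcaW, Matrix.smul_apply, smul_eq_mul, abs_mul, abs_of_pos hsp] at this
      rw [mul_comm]; exact this
    refine (noiseSize_le_of_bounded hu (by positivity) hnoise hb).trans (le_of_eq ?_)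
    rw [Real.sqrt_mul hD]; field_simp
  have hBs : ∀ j, noiseSize P (B.col j) ≤ C₁ * (√D * √p) := fun j => by
    rw [← Real.sqrt_mul hD]
    exact noiseSize_le_of_bounded hu hC₁ hnoise fun a => hBb a j
  have hVt : ∀ i, euclNorm (Bᵀ *ᵥ V.col i) ≤ √C * √p := fun i => by
    simpa [hVnorm] using euclNorm_transpose_mulVec_le hB hμC hC (V.col i)
  have hBn : ∀ j, euclNorm (B.col j) ≤ √C * √p := fun j => by
    refine abs_le_of_sq_le_sq' ?_ (by positivity) |>.2
    rw [euclNorm_col_sq hB, mul_pow, Real.sq_sqrt hC, hpp]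
    nlinarith [hμC j]
  have hBt : ∀ j, euclNorm (Bᵀ *ᵥ B.col j) ≤ C * p := fun j => by
    refine (euclNorm_transpose_mulVec_le hB hμC hC (B.col j)).trans ?_
    calc √C * √p * euclNorm (B.col j) ≤ √C * √p * (√C * √p) :=
          mul_le_mul_of_nonneg_left (hBn j) (by positivity)
      _ = √C ^ 2 * √(p : ℝ) ^ 2 := by ring
      _ = _ := by rw [Real.sq_sqrt hC, hpp]
  set K := C * C₃ * √D + C₁ * √D * √C + C₁ * C₃ * D with hK
  have hDD : √D * √D = D := Real.mul_self_sqrt hD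
  have hK0 : 0 ≤ K := by positivity
  have hsp1 : √(p : ℝ) ≤ p := by
    have h1 : (1 : ℝ) ≤ √p := Real.one_le_sqrt.mpr (by exact_mod_cast hp)
    nlinarith
  -- The sharp bound: both arguments are flat, so the three population terms are each `O(p)` and sum
  -- to `p K`. After division by the gap and by `√p` this leaves `K / √p`.
  have hcross : ∀ i j, |B.col j ⬝ᵥ (S - B * Bᵀ) *ᵥ V.col i| ≤ p * (√C * √p * τ + K) := by
    intro i j
    refine (abs_bilin_error_le hf hu hcov hS _ _).trans ?_
    rw [hVnorm, mul_one]
    have h1 := mul_le_mul (hBt j) (hVs i) (noiseSize_nonneg _) (by positivity)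
    have h2 := mul_le_mul (hBs j) (hVt i) (euclNorm_nonneg _) (by positivity)
    have h3 := mul_le_mul (hBs j) (hVs i) (noiseSize_nonneg _) (by positivity)
    have h4 := mul_le_mul_of_nonneg_left (hBn j) (mul_nonneg hp'.le hτ)
    have h5 : C₁ * (√D * √p) * (C₃ * √D) ≤ C₁ * C₃ * D * p := by
      calc _ = C₁ * C₃ * (√D * √D) * √p := by ring
        _ ≤ _ := by rw [hDD]; gcongr
    have h6 : C₁ * (√D * √p) * (√C * √p) = C₁ * √D * √C * p := by
      calc _ = C₁ * √D * √C * √(p : ℝ) ^ 2 := by ring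
        _ = _ := by rw [hpp]
    rw [hK]
    nlinarith
  have hs : ∀ (i : Fin d) (j : Fin r), d ≤ j.1 →
      (B.col j ⬝ᵥ V.col (Fin.castLE (hdr.le.trans hrk) i)) ^ 2 ≤
        (2 / c * (√C * √p * τ + K)) ^ 2 := fun i j hj => by
    have h1 := hV.abs_col_dotProduct_le hp hrk hdr.le hB hc hμ hgap
      (fun x => by simpa [← sq, euclNorm_sq] using hop x x) (hη.trans (by linarith)) i j hj
    have h2 := h1.trans (mul_le_mul_of_nonneg_left (hcross _ j) (by positivity))
    have h3 : 2 / (p * c) * (p * (√C * √p * τ + K)) = 2 / c * (√C * √p * τ + K) := by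
      field_simp
    rw [h3] at h2
    rw [← sq_abs]
    exact pow_le_pow_left₀ (abs_nonneg _) h2 2
  have ht : ∀ i : Fin d, noiseSize P (V.col (Fin.castLE (hdr.le.trans hrk) i)) ^ 2 ≤
      C₃ ^ 2 * D := fun i => by
    refine (pow_le_pow_left₀ (noiseSize_nonneg _) (hVs _) 2).trans (le_of_eq ?_)
    rw [mul_pow, Real.sq_sqrt hD]
  refine (reprError_le (hdr.le.trans hrk) hdr.le hp hf hu hcov (half_pos hc) hunit hlow hs
    (sq_nonneg _) (by positivity) ht).trans (le_of_eq ?_)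
  congr 2
  have h1 : (2 / c * (√C * √p * τ + K)) ^ 2 = 4 / c ^ 2 * p * (√C * τ + K * (√p)⁻¹) ^ 2 := by
    have h2 : √C * √p * τ + K = √p * (√C * τ + K * (√p)⁻¹) := by field_simp
    rw [h2, mul_pow, mul_pow, hpp]; ring
  rw [h1, inv_pow, hpp]
  field_simp
  ring

end Perturbation

/-! ### From the eigenvalues of the Gram matrix to the column norms. -/

/-- Both sides are the roots of the characteristic polynomial. Only multisets are compared, because
`eigenvalues` has its own indexing. -/
theorem map_diag_eq_map_eigenvalues {ι : Type*} [Fintype ι] [DecidableEq ι] {A : Matrix ι ι ℝ}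
    (hA : A.IsHermitian) {ν : ι → ℝ} (hν : A = diagonal ν) :
    Finset.univ.val.map ν = Finset.univ.val.map hA.eigenvalues := by
  have h1 := hA.roots_charpoly_eq_eigenvalues
  have h2 : A.charpoly = (Multiset.map (fun a => Polynomial.X - Polynomial.C a)
      (Finset.univ.val.map ν)).prod := by
    rw [hν, charpoly_diagonal, Multiset.map_map]; rfl
  rw [h2, Polynomial.roots_multiset_prod_X_sub_C] at h1
  simpa using h1

/-- The loading columns have squared norms `p μ_j`, where the `μ_j` inherit the bounds and the gaps
of the eigenvalues of the Gram matrix. -/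
theorem exists_loading_diagonal {p r : ℕ} {B : Matrix (Fin p) (Fin r) ℝ} (hp : 0 < p)
    (horth : (Bᵀ * B).IsDiag) (hord : Antitone fun j : Fin r => ∑ i, (B i j) ^ 2) {c C : ℝ}
    (hc : 0 < c)
    (heig : ∀ i, c ≤ (loadingGram_isHermitian B).eigenvalues i ∧
      (loadingGram_isHermitian B).eigenvalues i ≤ C)
    (hgap : ∀ i j, i ≠ j → c ≤ |(loadingGram_isHermitian B).eigenvalues i -
      (loadingGram_isHermitian B).eigenvalues j|) :
    ∃ ν : Fin r → ℝ, Bᵀ * B = diagonal (fun j => (p : ℝ) * ν j) ∧ (∀ j, c ≤ ν j) ∧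
      (∀ j, ν j ≤ C) ∧ ∀ i j, i < j → c ≤ ν i - ν j := by
  have hp' : (0 : ℝ) < p := by exact_mod_cast hp
  let ν : Fin r → ℝ := fun j => (p : ℝ)⁻¹ * (Bᵀ * B) j j
  have hdiag : Bᵀ * B = diagonal fun j => (Bᵀ * B) j j := horth.diagonal_diag.symm
  have hgram : loadingGram B = diagonal ν := by
    rw [loadingGram, hdiag, ← diagonal_smul]; simp only [ν]; congr 1
  have hmap := map_diag_eq_map_eigenvalues (loadingGram_isHermitian B) hgram
  have hmem : ∀ j, ∃ i, (loadingGram_isHermitian B).eigenvalues i = ν j := fun j => by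
    have : ν j ∈ Finset.univ.val.map (loadingGram_isHermitian B).eigenvalues := by
      rw [← hmap]; exact Multiset.mem_map_of_mem ν (Finset.mem_univ j)
    obtain ⟨i, -, hi⟩ := Multiset.mem_map.mp this
    exact ⟨i, hi⟩
  have hinj : Function.Injective (loadingGram_isHermitian B).eigenvalues := fun i j hij => by
    by_contra hne
    have := hgap i j hne
    rw [hij, sub_self, abs_zero] at this
    linarith
  -- Distinctness must come from the multiset having no repetition: membership alone could send two
  -- columns to the same eigenvalue.
  have hνinj : ∀ i j, ν i = ν j → i = j := fun i j hij => by
    have h1 : (Finset.univ.val.map ν).Nodup := by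
      rw [hmap]; exact Finset.univ.nodup.map hinj
    exact (Multiset.nodup_map_iff_inj_on Finset.univ.nodup).mp h1 i (Finset.mem_univ i) j
      (Finset.mem_univ j) hij
  have hanti : Antitone ν := fun i j hij => by
    have h1 : ∀ j, (Bᵀ * B) j j = ∑ i, B i j ^ 2 := fun j => by
      rw [mul_apply]; exact Finset.sum_congr rfl fun i _ => (sq _).symm
    simp only [ν, h1]
    exact mul_le_mul_of_nonneg_left (hord hij) (inv_nonneg.mpr hp'.le)
  refine ⟨ν, ?_, fun j => ?_, fun j => ?_, fun i j hij => ?_⟩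
  · rw [hdiag]
    congr 1
    ext j
    simp only [ν]
    field_simp
  · obtain ⟨i, hi⟩ := hmem j
    exact hi ▸ (heig i).1
  · obtain ⟨i, hi⟩ := hmem j
    exact hi ▸ (heig i).2
  · obtain ⟨a, ha⟩ := hmem i
    obtain ⟨b, hb⟩ := hmem j
    have hab : a ≠ b := fun h => hij.ne (hνinj i j (by rw [← ha, ← hb, h]))
    have := hgap a b hab
    rwa [ha, hb, abs_of_nonneg (sub_nonneg.mpr (hanti hij.le))] at this

/-! ### Bounds on the predictor, the rate, and the main theorem. -/

theorem abs_predictor_le {r p : ℕ} {B : Matrix (Fin p) (Fin r) ℝ} {z : FactorDraw r p} {b m : ℝ}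
    (hB : ∀ i j, |B i j| ≤ b) (hf : ∀ i, |z.1 i| ≤ m) (hu : ∀ i, |z.2 i| ≤ m) (a : Fin p) :
    |predictor B z a| ≤ r * (b * m) + m := by
  refine (abs_add_le _ _).trans (add_le_add ?_ (hu a))
  change |∑ j, B a j * z.1 j| ≤ _
  refine (Finset.abs_sum_le_sum_abs _ _).trans ?_
  have : ∀ j ∈ Finset.univ, |B a j * z.1 j| ≤ b * m := fun j _ => by
    rw [abs_mul]
    exact mul_le_mul (hB a j) (hf j) (abs_nonneg _) ((abs_nonneg _).trans (hB a j))
  simpa using Finset.sum_le_card_nsmul _ _ _ this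

theorem integral_predictor_eq_zero {r p : ℕ} {P : Measure (FactorDraw r p)}
    [IsProbabilityMeasure P] {B : Matrix (Fin p) (Fin r) ℝ} {m : ℝ}
    (hf : ∀ᵐ z ∂P, ∀ i, |z.1 i| ≤ m) (hu : ∀ᵐ z ∂P, ∀ i, |z.2 i| ≤ m)
    (hf_mean : ∀ i, ∫ z, z.1 i ∂P = 0) (hu_mean : ∀ j, ∫ z, z.2 j ∂P = 0) (a : Fin p) :
    ∫ z, predictor B z a ∂P = 0 := by
  have hF : ∀ j, Integrable (fun z : FactorDraw r p => B a j * z.1 j) P := fun j =>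
    ((memLp_factor hf j).integrable one_le_two).const_mul _
  have h : ∀ z : FactorDraw r p, predictor B z a = ∑ j, B a j * z.1 j + z.2 a := fun z => rfl
  simp only [h]
  rw [integral_add (integrable_finsetSum _ fun j _ => hF j)
    ((memLp_noise hu a).integrable one_le_two), integral_finsetSum _ fun j _ => hF j, hu_mean]
  simp [integral_const_mul, hf_mean]

theorem inv_sqrt_add_le_pcaRate (n p : ℕ) : (√(n : ℝ))⁻¹ + (√(p : ℝ))⁻¹ ≤ pcaRate n p := by
  have h : ∀ x : ℝ, 0 ≤ x → x ^ (-(1 / 2) : ℝ) = (√x)⁻¹ := fun x hx => by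
    rw [Real.rpow_neg hx, Real.sqrt_eq_rpow]
  rw [pcaRate, h _ (Nat.cast_nonneg n), h _ (Nat.cast_nonneg p)]
  have : 0 ≤ ((n : ℝ) / Real.log p) ^ (-(1 / 2) : ℝ) :=
    Real.rpow_nonneg (div_nonneg (Nat.cast_nonneg n) (Real.log_natCast_nonneg p)) _
  linarith

theorem sqrt_rate_le {q s A K R x y δ : ℝ} (hq : 0 ≤ q) (hs : 0 ≤ s) (hA : 0 ≤ A) (hK : 0 ≤ K)
    (hR : 0 ≤ R) (hx : 0 ≤ x) (hy : 0 ≤ y) (hδ : x + y ≤ δ) :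
    √(q * (s * (A * x + K * y) ^ 2 + R * y ^ 2)) ≤ √(q * (s * (A + K) ^ 2 + R)) * δ := by
  have hδ0 : 0 ≤ δ := (add_nonneg hx hy).trans hδ
  have h1 : A * x + K * y ≤ (A + K) * δ := by nlinarith
  have h2 : y ≤ δ := by linarith
  rw [← Real.sqrt_sq hδ0, ← Real.sqrt_mul (by positivity)]
  refine Real.sqrt_le_sqrt ?_
  calc q * (s * (A * x + K * y) ^ 2 + R * y ^ 2)
      ≤ q * (s * ((A + K) * δ) ^ 2 + R * δ ^ 2) := by gcongr
    _ = _ := by ring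

theorem mainTheorem12
    -- dimensions: `r` factors, working order `d`, `p n` predictors, upper bound `dmax n`
    (r d : ℕ) (hd : 1 ≤ d) (hdr : d < r)
    (p dmax : ℕ → ℕ) (hdmax : ∀ n, r ≤ dmax n)
    (hp : Tendsto p atTop atTop)
    (hlog : Tendsto (fun n : ℕ => Real.log (p n) / (n : ℝ)) atTop (𝓝 0))
    -- the population: loading matrices and the joint laws of factors and noise
    (B : ∀ n, Matrix (Fin (p n)) (Fin r) ℝ)
    (P : ∀ n, Measure (FactorDraw r (p n))) [∀ n, IsProbabilityMeasure (P n)]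
    -- normalization: uncorrelated unit-variance factors, orthogonal ordered loading columns
    (hcov : ∀ n, ∀ i j : Fin r,
      ∫ z, z.1 i * z.1 j ∂(P n) = (1 : Matrix (Fin r) (Fin r) ℝ) i j)
    (horth : ∀ n, ((B n)ᵀ * B n).IsDiag)
    (hord : ∀ n, Antitone fun j : Fin r => ∑ i, (B n i j) ^ 2)
    -- the i.i.d. sample, and the training indices on which the reduction map is fitted
    {Ω : ℕ → Type*} [∀ n, MeasurableSpace (Ω n)] (μ : ∀ n, Measure (Ω n))
    [∀ n, IsProbabilityMeasure (μ n)]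
    (Z : ∀ n, Fin n → Ω n → FactorDraw r (p n))
    (hlaw : ∀ n, ∀ i, HasLaw (Z n i) (P n) (μ n))
    (hindep : ∀ n, iIndepFun (Z n) (μ n))
    (T : ∀ n, Finset (Fin n)) (κ : ℝ) (hκ : 0 < κ)
    (hT : ∀ᶠ n : ℕ in atTop, κ * (n : ℝ) ≤ ((T n).card : ℝ))
    -- leading eigenvectors of the sample covariance matrix of the training predictors
    (V : ∀ n, Ω n → Matrix (Fin (p n)) (Fin (dmax n)) ℝ)
    (hV : ∀ n, ∀ ω,
      IsLeadingEigenvectors (sampleCov (T n) fun i => predictor (B n) (Z n i ω)) (V n ω))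
    -- boundedness
    (C₁ C₂ C₃ : ℝ)
    (hB : ∀ n, ∀ i j, |B n i j| ≤ C₁)
    (hf_mean : ∀ n, ∀ i, ∫ z, z.1 i ∂(P n) = 0)
    (hf_bdd : ∀ n, ∀ᵐ z ∂(P n), ∀ i, |z.1 i| ≤ C₂)
    (hu_mean : ∀ n, ∀ j, ∫ z, z.2 j ∂(P n) = 0)
    (hu_bdd : ∀ n, ∀ᵐ z ∂(P n), ∀ j, |z.2 j| ≤ C₂)
    -- weak dependence
    (hweak : (fun n => ∑ j, ∑ j' ∈ Finset.univ.erase j, |∫ z, z.2 j * z.2 j' ∂(P n)|)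
      =O[atTop] fun n => (p n : ℝ))
    -- bounded projection matrix
    (hW : Tendsto (fun n => μ n {ω | ∃ i j, C₃ < |pcaW (V n ω) i j|}) atTop (𝓝 0))
    -- pervasiveness with separated eigenvalues
    (c C : ℝ) (hc : 0 < c)
    (heig : ∀ᶠ n in atTop, ∀ i,
      c ≤ (loadingGram_isHermitian (B n)).eigenvalues i ∧
        (loadingGram_isHermitian (B n)).eigenvalues i ≤ C)
    (hgap : ∀ᶠ n in atTop, ∀ i j, i ≠ j →
      c ≤ |(loadingGram_isHermitian (B n)).eigenvalues i -
        (loadingGram_isHermitian (B n)).eigenvalues j|) :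
    Tendsto (fun n => μ n {ω |
        ¬ IsUnit (pcaH (hdr.le.trans (hdmax n)) hdr.le (pcaW (V n ω)) (B n))}) atTop (𝓝 0) ∧
      IsBigOP μ
        (fun n ω => reprError (hdr.le.trans (hdmax n)) hdr.le (P n) (B n) (pcaW (V n ω))
          (pcaH (hdr.le.trans (hdmax n)) hdr.le (pcaW (V n ω)) (B n))⁻¹)
        (fun n => pcaRate n (p n)) := by
  -- One exceptional set serves both conclusions; only monotonicity of the measure is used, so the
  -- events need not be measurable.
  suffices key : ∀ ε : ℝ, 0 < ε → ∃ M : ℝ, 0 < M ∧ ∀ᶠ n in atTop, ∃ bad : Set (Ω n),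
      μ n bad ≤ ENNReal.ofReal ε ∧ ∀ ω ∉ bad,
        IsUnit (pcaH (hdr.le.trans (hdmax n)) hdr.le (pcaW (V n ω)) (B n)) ∧
        reprError (hdr.le.trans (hdmax n)) hdr.le (P n) (B n) (pcaW (V n ω))
          (pcaH (hdr.le.trans (hdmax n)) hdr.le (pcaW (V n ω)) (B n))⁻¹ ≤
          ENNReal.ofReal (M * pcaRate n (p n)) by
    constructor
    · rw [ENNReal.tendsto_nhds_zero]
      intro ε hε
      obtain ⟨δ, hδ, hδε⟩ : ∃ δ : ℝ, 0 < δ ∧ ENNReal.ofReal δ ≤ ε := by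
        rcases eq_or_ne ε ∞ with rfl | htop
        · exact ⟨1, one_pos, le_top⟩
        · exact ⟨ε.toReal, ENNReal.toReal_pos hε.ne' htop, (ENNReal.ofReal_toReal htop).le⟩
      obtain ⟨M, -, hM⟩ := key δ hδ
      filter_upwards [hM] with n ⟨bad, hbad, hgood⟩
      refine (measure_mono fun ω hω => ?_).trans (hbad.trans hδε)
      by_contra hnot
      exact hω (hgood ω hnot).1
    · intro ε hε
      obtain ⟨M, hM0, hM⟩ := key ε hε
      refine ⟨M, hM0, ?_⟩
      filter_upwards [hM] with n ⟨bad, hbad, hgood⟩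
      refine (measure_mono fun ω hω => ?_).trans hbad
      by_contra hnot
      exact (hgood ω hnot).2.not_gt hω
  intro ε hε
  have hC : 0 ≤ C := by
    obtain ⟨n, hn⟩ := heig.exists
    exact hc.le.trans ((hn ⟨d, hdr⟩).1.trans (hn ⟨d, hdr⟩).2)
  obtain ⟨D₀, hD₀⟩ := hweak.bound
  -- `C₂ ^ 2` covers the diagonal of the noise covariance, `|D₀|` its off-diagonal part.
  set D : ℝ := C₂ ^ 2 + |D₀| with hDdef
  have hD : 0 ≤ D := by positivity
  set K : ℝ := r * (|C₁| * |C₂|) + |C₂| with hKdef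
  -- With `τ n ^ 2 = L / n` and at least `κ n` training points, Markov's bound is at most `4 K ^ 4 /
  -- (κ L) ≤ ε / 2`. The `+ 1` keeps `L` positive when `K = 0`.
  set L : ℝ := 8 * K ^ 4 / (κ * ε) + 1 with hLdef
  have hL : 0 < L := by positivity
  set K' : ℝ := C * |C₃| * √D + |C₁| * √D * √C + |C₁| * |C₃| * D with hK'def
  have hpR : Tendsto (fun n => (√(p n : ℝ))⁻¹) atTop (𝓝 0) :=
    (Real.tendsto_sqrt_atTop.comp (tendsto_natCast_atTop_atTop.comp hp)).inv_tendsto_atTop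
  have hnR : Tendsto (fun n : ℕ => (√(n : ℝ))⁻¹) atTop (𝓝 0) :=
    (Real.tendsto_sqrt_atTop.comp tendsto_natCast_atTop_atTop).inv_tendsto_atTop
  set θ : ℕ → ℝ := fun n => |C₂| * √D * (√(p n : ℝ))⁻¹ with hθdef
  set τ : ℕ → ℝ := fun n => √L * (√(n : ℝ))⁻¹ with hτdef
  have hθlim : Tendsto θ atTop (𝓝 0) := by simpa using hpR.const_mul (|C₂| * √D)
  have hτlim : Tendsto τ atTop (𝓝 0) := by simpa using hnR.const_mul √L
  have hηlim : Tendsto (fun n => τ n + 2 * √C * √(θ n) + θ n) atTop (𝓝 0) := by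
    have h1 : Tendsto (fun n => √(θ n)) atTop (𝓝 0) := by
      simpa [Function.comp_def] using (Real.continuous_sqrt.tendsto 0).comp hθlim
    simpa using (hτlim.add (h1.const_mul (2 * √C))).add hθlim
  have hη2lim : Tendsto (fun n => (r : ℝ) ^ 2 * C * (τ n + 2 * √C * √(θ n) + θ n) ^ 2) atTop
      (𝓝 0) := by simpa using (hηlim.pow 2).const_mul ((r : ℝ) ^ 2 * C)
  refine ⟨√(4 * d / c * (4 * r / c ^ 2 * (√C * √L + K') ^ 2 + |C₃| ^ 2 * D)) + 1,
    by positivity, ?_⟩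
  have hWε := ENNReal.tendsto_nhds_zero.mp hW (ENNReal.ofReal (ε / 2))
    (ENNReal.ofReal_pos.mpr (half_pos hε))
  filter_upwards [heig, hgap, hT, hD₀, hWε, hp.eventually_gt_atTop 0, eventually_gt_atTop 0,
    hηlim.eventually_le_const (show 0 < c / 8 by positivity),
    hη2lim.eventually_le_const (show 0 < c ^ 3 / 16 by positivity)] with
    n heign hgapn hTn hDn hWn hpn hn hηn hη2n
  have hp' : (0 : ℝ) < p n := by exact_mod_cast hpn
  have hn' : (0 : ℝ) < n := by exact_mod_cast hn
  have hTpos : (0 : ℝ) < (T n).card := (mul_pos hκ hn').trans_le hTn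
  have hTne : (T n).Nonempty := Finset.card_pos.mp (by exact_mod_cast hTpos)
  obtain ⟨ν, hBν, hνc, hνC, hνgap⟩ := exists_loading_diagonal hpn (horth n) (hord n) hc heign hgapn
  have hf : ∀ᵐ z ∂(P n), ∀ i, |z.1 i| ≤ |C₂| :=
    (hf_bdd n).mono fun z hz i => (hz i).trans (le_abs_self _)
  have hu : ∀ᵐ z ∂(P n), ∀ i, |z.2 i| ≤ |C₂| :=
    (hu_bdd n).mono fun z hz i => (hz i).trans (le_abs_self _)
  have hB' : ∀ i j, |B n i j| ≤ |C₁| := fun i j => (hB n i j).trans (le_abs_self _)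
  have hnoise : ∑ a, ∑ b, |noiseCov (P n) a b| ≤ D * p n := by
    have h1 : ∑ j, ∑ j' ∈ Finset.univ.erase j, |∫ z, z.2 j * z.2 j' ∂(P n)| ≤ |D₀| * p n := by
      refine (le_abs_self _).trans (hDn.trans ?_)
      rw [Real.norm_of_nonneg hp'.le]
      exact mul_le_mul_of_nonneg_right (le_abs_self _) hp'.le
    refine (sum_abs_noiseCov_le (hu_bdd n) h1).trans (le_of_eq ?_)
    rw [hDdef]; ring
  have hθn : ∀ x, noiseSize (P n) x ^ 2 ≤ p n * θ n * (x ⬝ᵥ x) := fun x => by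
    refine (noiseSize_sq_le (hu_bdd n) hnoise x).trans (le_of_eq ?_)
    have hpp : (p n : ℝ) = √(p n : ℝ) * √(p n : ℝ) := (Real.mul_self_sqrt hp'.le).symm
    have hsp : √(p n : ℝ) ≠ 0 := (Real.sqrt_pos.mpr hp').ne'
    have : (p n : ℝ) * θ n = |C₂| * (√D * √(p n : ℝ)) := by
      simp only [hθdef]
      nth_rewrite 1 [hpp]
      field_simp
    rw [this, Real.sqrt_mul hD]
  have hτ0 : 0 < τ n := by
    have := Real.sqrt_pos.mpr hn'
    have := Real.sqrt_pos.mpr hL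
    simp only [hτdef]
    positivity
  have hX : ∀ᵐ z ∂(P n), ∀ a, |predictor (B n) z a| ≤ K := by
    filter_upwards [hf, hu] with z hz1 hz2 a using abs_predictor_le hB' hz1 hz2 a
  have htail := measure_frobNorm_sampleCov_sub_le (B := B n) (hlaw n) (hindep n) hTne hX
    (integral_predictor_eq_zero hf hu (hf_mean n) (hu_mean n)) hpn hτ0
  have hsmall : 4 * K ^ 4 / ((T n).card * τ n ^ 2) ≤ ε / 2 := by
    have h1 : τ n ^ 2 = L / n := by
      simp only [hτdef]
      rw [mul_pow, inv_pow, Real.sq_sqrt hL.le, Real.sq_sqrt hn'.le, div_eq_mul_inv]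
    have h2 : κ * L ≤ (T n).card * τ n ^ 2 := by
      rw [h1, ← mul_div_assoc, le_div_iff₀ hn']
      nlinarith
    rw [div_le_iff₀ ((mul_pos hκ hL).trans_le h2)]
    have h3 : ε / 2 * (κ * L) = 4 * K ^ 4 + ε / 2 * κ := by
      rw [hLdef]; field_simp; ring
    have h4 : ε / 2 * (κ * L) ≤ ε / 2 * ((T n).card * τ n ^ 2) := by gcongr
    have h5 : 0 < ε / 2 * κ := by positivity
    linarith
  -- Half of `ε` pays for a large covariance error, half for an unbounded projection matrix.
  refine ⟨{ω | p n * τ n < frobNorm (sampleCov (T n) (fun i => predictor (B n) (Z n i ω)) -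
    predictorCov (P n) (B n))} ∪ {ω | ∃ i j, C₃ < |pcaW (V n ω) i j|}, ?_, fun ω hω => ?_⟩
  · refine (measure_union_le _ _).trans ?_
    rw [← add_halves ε, ENNReal.ofReal_add (half_pos hε).le (half_pos hε).le]
    exact add_le_add (htail.trans (ENNReal.ofReal_le_ofReal hsmall)) hWn
  · simp only [Set.mem_union, Set.mem_ofPred_eq, not_or, not_lt, not_exists] at hω
    obtain ⟨hunit, herr⟩ := (hV n ω).isUnit_pcaH_and_reprError_le hpn (hdmax n) hdr hf hu (hcov n)
      hBν hc hνc hνC hνgap (abs_nonneg C₁) hB' (abs_nonneg C₃)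
      (fun i j => (hω.2 i j).trans (le_abs_self _)) hD hnoise hτ0.le hω.1
      (by simp only [hθdef]; positivity) hθn hηn hη2n
    refine ⟨hunit, herr.trans (ENNReal.ofReal_le_ofReal ?_)⟩
    have hrate := inv_sqrt_add_le_pcaRate n (p n)
    have hrate0 : 0 ≤ pcaRate n (p n) := le_trans (by positivity) hrate
    have h1 : √C * τ n = √C * √L * (√(n : ℝ))⁻¹ := by simp only [hτdef]; ring
    rw [h1]
    refine (sqrt_rate_le (by positivity) (by positivity) (by positivity) (by positivity)
      (by positivity) (by positivity) (by positivity) hrate).trans ?_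
    exact mul_le_mul_of_nonneg_right (by linarith) hrate0
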